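/- Fix an integer $r\ge 3$. Let $N$ be the number of independent Bernoulli trials with success probability $p\in(0,1)$ needed to obtain $r$ successes, so that $f(n)=\Pr[N=n]=\frac{(n-1)(n-2)\cdots(n-r+1)}{(r-1)!}\,p^r(1-p)^{n-r}$ for $n\ge r$. A (possibly randomized) estimator $\hat p$ of $p$ assigns to each $n\ge r$ a probability distribution $\Pi_n$ on $\mathbb R^+=(0,\infty)$, the conditional distribution of $\hat p$ given $N=n$; the estimator $\hat p=g(N)$ corresponds to $\Pi_n=\delta_{g(n)}$. For a loss function $L:\mathbb R^+\to[0,\infty)$ the risk of $\hat p$ is $$\eta(p)=\mathrm E[L(\hat p/p)]=\sum_{n=r}^\infty f(n)\int_0^\infty L(y/p)\,\mathrm d\Pi_n(y)\in[0,\infty].$$ Assume that $L$ satisfies the following. 1. $L$ is of bounded variation on $[x_1,x_2]$ for all $0<x_1<x_2<\infty$. 2. $L$ has only finitely many discontinuities in $\mathbb R^+$. 3. There are real $K<r$ and $K'<r$ such that $L(x)=\Theta(x^{K})$ as $x\to0^+$ and $L(x)=\Theta(x^{K'})$ as $x\to\infty$. 4. (a) There is $\xi>0$ such that $L$ is non-increasing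 on $(0,\xi)$ and $\int_\xi^\infty \frac{L(\xi)-L(x)}{x^{r+1}}\,\mathrm dx>0$. (b) There is $\xi'>0$ such that $L$ is non-decreasing on $(\xi',\infty)$ and either $L(\xi'-)<L(\xi'+)$ (one-sided limits), or for some integer $t\ge1$ the function $L$ is of class $C^t$ on an open interval containing $\xi'$, with $L^{(i)}(\xi')=0$ for $1\le i\le t-1$ and $(-1)^{t-1}L^{(t)}(\xi')>0$. For $\Omega>0$ let $$\bar\eta(\Omega)=\int_0^\infty \frac{\nu^{r-1}e^{-\nu}}{(r-1)!}\,L(\Omega/\nu)\,\mathrm d\nu ,$$ and let $\Omega^*>0$ be any minimizer of $\bar\eta$ over $(0,\infty)$. Suppose that there are $\upsilon,\upsilon'>0$ with $$\upsilon\le\frac{\Omega^*}{r+\sqrt r+1},\qquad \upsilon'\ge\frac{\Omega^*}{r-\sqrt r},$$ such that $L$ is constant on $[\upsilon,\upsilon']$, non-increasing on $(0,\upsilon]$ and non-decreasing on $[\upsilon',\infty)$. Then the estimator $\hat p=\Omega^*/(N+1)$ minimizes $\sup_{p\in(0,1)}\eta(p)$ among all (possibly randomized) estimators based on inverse binomial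 sampling; that is, it is minimax. -/

import Mathlib

open Set Filter Topology MeasureTheory
open scoped ENNReal

namespace InverseBinomial

noncomputable section

/-- The probability function `(n-1)⋯(n-r+1) p^r (1-p)^(n-r) / (r-1)!` of the number `N` of Bernoulli trials with success
probability `p` needed to obtain `r` successes; used for `n ≥ r`. -/
def trialsPMF (r : ℕ) (p : ℝ) (n : ℕ) : ℝ :=
  ((n - 1).descFactorial (r - 1) : ℝ) / ((r - 1).factorial : ℝ) * p ^ r * (1 - p) ^ (n - r)

/-- A (possibly randomized) estimator based on inverse binomial sampling: to every value `n ≥ r` of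
`N` it assigns the conditional distribution of the positive random variable `p̂` given `N = n`. -/
def Estimator (r : ℕ) : Type :=
  {n : ℕ // r ≤ n} → ProbabilityMeasure (Ioi (0 : ℝ))

/-- The non-randomized estimator `p̂ = g(N)`. -/
def Estimator.ofFun {r : ℕ} (g : {n : ℕ // r ≤ n} → Ioi (0 : ℝ)) : Estimator r :=
  fun n => diracProba (g n)

/-- The estimator `p̂ = Ω / (N + 1)`. -/
def Estimator.divSucc (r : ℕ) (Ω : ℝ) (hΩ : 0 < Ω) : Estimator r :=
  Estimator.ofFun fun n => ⟨Ω / ((n.1 : ℝ) + 1), div_pos hΩ (by positivity)⟩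

/-- The risk `η(p) = E[L(p̂ / p)]`, possibly infinite. Loss functions are functions on `ℝ` of which
only the values on `(0, ∞)` matter. -/
def risk (r : ℕ) (L : ℝ → ℝ) (G : Estimator r) (p : ℝ) : ℝ≥0∞ :=
  ∑' n : {n : ℕ // r ≤ n}, ENNReal.ofReal (trialsPMF r p n.1) *
    ∫⁻ y : Ioi (0 : ℝ), ENNReal.ofReal (L ((y : ℝ) / p)) ∂(G n : Measure (Ioi (0 : ℝ)))

/-- `sup_{p ∈ (0,1)} η(p)`. -/
def supRisk (r : ℕ) (L : ℝ → ℝ) (G : Estimator r) : ℝ≥0∞ :=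
  ⨆ p ∈ Ioo (0 : ℝ) 1, risk r L G p

/-- `φ(ν) = ν^(r-1) exp(-ν) / (r-1)!`. -/
def phi (r : ℕ) (ν : ℝ) : ℝ :=
  ν ^ (r - 1) * Real.exp (-ν) / ((r - 1).factorial : ℝ)

/-- The asymptotic risk `∫₀^∞ φ(ν) L(Ω/ν) dν` as a function of `Ω > 0`. -/
def asymptoticRisk (r : ℕ) (L : ℝ → ℝ) (Ω : ℝ) : ℝ≥0∞ :=
  ∫⁻ ν in Ioi (0 : ℝ), ENNReal.ofReal (phi r ν * L (Ω / ν))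

/-- `Ω` is a positive number that minimizes the asymptotic risk among all positive numbers. -/
def IsOptimalOmega (r : ℕ) (L : ℝ → ℝ) (Ω : ℝ) : Prop :=
  0 < Ω ∧ ∀ Ω' : ℝ, 0 < Ω' → asymptoticRisk r L Ω ≤ asymptoticRisk r L Ω'

/-- A loss function is non-negative on `(0, ∞)`. -/
def IsLoss (L : ℝ → ℝ) : Prop :=
  ∀ x : ℝ, 0 < x → 0 ≤ L x

/-- `L` is of bounded variation on every compact subinterval of `(0, ∞)`. -/
def HasLocallyBoundedVariation (L : ℝ → ℝ) : Prop :=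
  ∀ x₁ x₂ : ℝ, 0 < x₁ → x₁ < x₂ → BoundedVariationOn L (Icc x₁ x₂)

/-- `L` has finitely many discontinuities in `(0, ∞)`. -/
def HasFinitelyManyDiscontinuities (L : ℝ → ℝ) : Prop :=
  {x : ℝ | 0 < x ∧ ¬ ContinuousAt L x}.Finite

/-- `L` is of exact power order, with exponents less than `r`, at `0+` and at `∞`. -/
def HasPowerOrder (r : ℕ) (L : ℝ → ℝ) : Prop :=
  (∃ K : ℝ, K < r ∧ L =Θ[𝓝[>] (0 : ℝ)] fun x : ℝ => x ^ K) ∧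
  (∃ K' : ℝ, K' < r ∧ L =Θ[atTop] fun x : ℝ => x ^ K')

/-- The condition on `L` near `0`. -/
def LeftShape (r : ℕ) (L : ℝ → ℝ) : Prop :=
  ∃ ξ : ℝ, 0 < ξ ∧ AntitoneOn L (Ioo 0 ξ) ∧
    0 < ∫ x in Ioi ξ, (L ξ - L x) / x ^ (r + 1)

/-- `L(a-) < L(a+)`. -/
def JumpsUpAt (L : ℝ → ℝ) (a : ℝ) : Prop :=
  ∃ l u : ℝ, Tendsto L (𝓝[<] a) (𝓝 l) ∧ Tendsto L (𝓝[>] a) (𝓝 u) ∧ l < u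

/-- For some `t ≥ 1`, `L` is of class `C^t` on an open subinterval of `(0, ∞)` containing `a`, the
derivatives of orders `1, …, t - 1` vanish at `a`, and `(-1)^(t-1) L^(t)(a) > 0`. -/
def SmoothlyRisesTo (L : ℝ → ℝ) (a : ℝ) : Prop :=
  ∃ t : ℕ, 1 ≤ t ∧
    (∃ α β : ℝ, 0 ≤ α ∧ α < a ∧ a < β ∧ ContDiffOn ℝ (t : WithTop ℕ∞) L (Ioo α β)) ∧
    (∀ i : ℕ, 1 ≤ i → i < t → iteratedDeriv i L a = 0) ∧
    0 < (-1 : ℝ) ^ (t - 1) * iteratedDeriv t L a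

/-- The condition on `L` near `∞`. -/
def RightShape (L : ℝ → ℝ) : Prop :=
  ∃ ξ' : ℝ, 0 < ξ' ∧ MonotoneOn L (Ioi ξ') ∧ (JumpsUpAt L ξ' ∨ SmoothlyRisesTo L ξ')

/-- `L` is constant on `[υ, υ']`, non-increasing on `(0, υ]` and non-decreasing on `[υ', ∞)`. -/
def IsConstantBetween (L : ℝ → ℝ) (υ υ' : ℝ) : Prop :=
  (∃ C : ℝ, ∀ x ∈ Icc υ υ', L x = C) ∧ AntitoneOn L (Ioc 0 υ) ∧ MonotoneOn L (Ici υ')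

end

end InverseBinomial

namespace InverseBinomial

/-! The asymptotic risk at `Ωstar` is both an upper bound for the worst-case risk of `Ωstar / (N +
1)` and a lower bound for that of every estimator.

Upper bound. For fixed p, compare the law of (N + 1)p with the mixture of Gamma(r) and Gamma(r + 1)
with weights 1 - p and p. Replacing Ω by Ωt and rescaling the integration variable turns the
asymptotic risk into t ^ r times a Laplace transform, so it is differentiable in t even when the
loss is not; its vanishing derivative at the minimizer says that the Gamma(r) and Gamma(r + 1) risks
coincide (`lintegral_phi_mul_id_eq`). Hence the mixture gives exactly the asymptotic risk for every
p. The law of (N + 1)p has the lighter tails: on the left up to r - √r (`scaledTrials_Iic_le`) and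
on the right from r + √r + 1 (`scaledTrials_Ici_le`). Since z ↦ L(Ω / z) decreases, then is constant
between these two points, then increases, lighter tails mean smaller risk
(`lintegral_le_of_tails_le`). The tail comparisons come from differentiating in p and bounding a
ratio of beta to gamma densities (`left_density_bound`, `right_density_bound`) by Stirling
monotonicity and a rational bound for the logarithm.

Lower bound. Average the risk over dp / p on (a, 1/2]. For each n, the substitution p = x / n makes
the contribution of N = n, whatever the reported value, at least nearly 1 / n times an asymptotic
risk (`mul_le_lintegral_trialsPMF`). Summing over n ≤ k yields about log k times the minimal
asymptotic risk, while the prior has mass about log k; let k → ∞ (`le_supRisk`). The limit needs a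
compact range of x that works for all Ω at once, given by `exists_truncation`. -/

/-! ### Stirling-type inequalities and bounds for the density ratio -/

theorem three_mul_sq_div_le_sub_log {t : ℝ} (ht : -1 < t) :
    3 * t ^ 2 / (6 + 4 * t) ≤ t - Real.log (1 + t) := by
  set h : ℝ → ℝ := fun t => t - Real.log (1 + t) - 3 * t ^ 2 / (6 + 4 * t) with hh
  -- The derivative has the sign of u, so the difference is minimal at 0, where it vanishes.
  have hd : ∀ u : ℝ, -1 < u → HasDerivAt h (u ^ 3 / ((1 + u) * (3 + 2 * u) ^ 2)) u := by
    intro u hu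
    have h1 : (1 + u) ≠ 0 := by linarith
    have h2 : (6 + 4 * u) ≠ 0 := by linarith
    have h3 : (3 + 2 * u) ≠ 0 := by linarith
    have e1 : HasDerivAt (fun t : ℝ => Real.log (1 + t)) (1 / (1 + u)) u :=
      ((hasDerivAt_id u).const_add 1).log h1
    have e2 : HasDerivAt (fun t : ℝ => 3 * t ^ 2) (3 * (2 * u)) u := by
      simpa using (hasDerivAt_pow 2 u).const_mul 3
    have e3 : HasDerivAt (fun t : ℝ => 6 + 4 * t) 4 u := by
      simpa using ((hasDerivAt_id u).const_mul 4).const_add 6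
    refine (((hasDerivAt_id u).sub e1).sub (e2.div e3 h2)).congr_deriv ?_
    change 1 - 1 / (1 + u) - (3 * (2 * u) * (6 + 4 * u) - 3 * u ^ 2 * 4) / (6 + 4 * u) ^ 2 = _
    rw [one_sub_div h1, div_sub_div _ _ h1 (pow_ne_zero 2 h2), div_eq_div_iff
      (mul_ne_zero h1 (pow_ne_zero 2 h2)) (mul_ne_zero h1 (pow_ne_zero 2 h3))]
    ring
  have h0 : h 0 = 0 := by simp [hh]
  have hc : ∀ s ⊆ Ioi (-1 : ℝ), ContinuousOn h s := fun s hs u hu =>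
    (hd u (hs hu)).continuousAt.continuousWithinAt
  suffices 0 ≤ h t by simp only [hh] at this; linarith
  rw [← h0]
  rcases le_total 0 t with h0t | h0t
  · refine monotoneOn_of_deriv_nonneg (convex_Icc 0 t) (hc _ fun u hu => ?_) ?_ ?_
      (left_mem_Icc.2 h0t) (right_mem_Icc.2 h0t) h0t
    · exact lt_of_lt_of_le (by norm_num) hu.1
    · intro u hu
      rw [interior_Icc] at hu
      exact (hd u (by linarith [hu.1])).differentiableAt.differentiableWithinAt
    · intro u hu
      rw [interior_Icc] at hu
      rw [(hd u (by linarith [hu.1])).deriv]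
      have := hu.1
      positivity
  · refine antitoneOn_of_deriv_nonpos (convex_Icc t 0) (hc _ fun u hu => ?_) ?_ ?_
      (left_mem_Icc.2 h0t) (right_mem_Icc.2 h0t) h0t
    · exact lt_of_lt_of_le ht hu.1
    · intro u hu
      rw [interior_Icc] at hu
      exact (hd u (by linarith [hu.1])).differentiableAt.differentiableWithinAt
    · intro u hu
      rw [interior_Icc] at hu
      rw [(hd u (by linarith [hu.1])).deriv]
      have h1 : 0 < 1 + u := by linarith [hu.1]
      have h2 : u ^ 3 ≤ 0 := by
        have : 0 ≤ (-u) ^ 3 := pow_nonneg (by linarith [hu.2]) 3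
        nlinarith
      exact div_nonpos_of_nonpos_of_nonneg h2 (by positivity)

theorem one_add_cubic_le_exp {z : ℝ} (hz : 0 ≤ z) :
    1 + z + z ^ 2 / 2 + z ^ 3 / 6 ≤ Real.exp z := by
  have := Real.sum_le_exp_of_nonneg hz 4
  simp [Finset.sum_range_succ, Nat.factorial] at this
  linarith

theorem one_add_div_pow_mul_exp_le {n : ℕ} (hn : 1 ≤ n) {w : ℝ} (hw : -(n : ℝ) < w) :
    ((n + w) / n) ^ n * Real.exp (-w) ≤ Real.exp (-(3 * w ^ 2 / (6 * n + 4 * w))) := by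
  have hn0 : (0 : ℝ) < n := by exact_mod_cast hn
  have ht : -1 < w / n := by rw [lt_div_iff₀ hn0]; linarith
  have h1 : 0 < (n + w) / n := div_pos (by linarith) hn0
  have h2 : (n + w) / n = 1 + w / n := by field_simp
  have h3 := three_mul_sq_div_le_sub_log ht
  have h4 : ((n + w) / n) ^ n = Real.exp (n * Real.log (1 + w / n)) := by
    rw [mul_comm, ← h2, Real.exp_mul, Real.exp_log h1, Real.rpow_natCast]
  rw [h4, ← Real.exp_add, Real.exp_le_exp]
  have h5 : n * (3 * (w / n) ^ 2 / (6 + 4 * (w / n))) = 3 * w ^ 2 / (6 * n + 4 * w) := by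
    have : (6 : ℝ) * n + 4 * w ≠ 0 := by nlinarith
    have : (6 : ℝ) + 4 * (w / n) ≠ 0 := by linarith
    field_simp
  have h6 : (n : ℝ) * (w / n) = w := by field_simp
  nlinarith [mul_le_mul_of_nonneg_left h3 hn0.le]

/-- This is the monotonicity of n! / (√(2n) (n / e) ^ n), read as a bound on the ratio of two of its
terms. -/
theorem descFactorial_mul_exp_le {n : ℕ} (hn : 1 ≤ n) (q : ℕ) :
    ((n + q).descFactorial q : ℝ) / ((n + q : ℕ) : ℝ) ^ q * (n / ((n + q : ℕ) : ℝ)) ^ n *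
      Real.exp q ≤ Real.sqrt (((n + q : ℕ) : ℝ) / n) := by
  have hS : Stirling.stirlingSeq (n + q) ≤ Stirling.stirlingSeq n := by
    obtain ⟨k, rfl⟩ := Nat.exists_eq_add_of_le' hn
    have := Stirling.stirlingSeq'_antitone (Nat.le_add_right k q)
    simpa [Nat.succ_eq_add_one, add_right_comm] using this
  have hn0 : (0 : ℝ) < n := by exact_mod_cast hn
  have hM0 : (0 : ℝ) < ((n + q : ℕ) : ℝ) := by exact_mod_cast (by omega : 0 < n + q)
  have hfac : ((n + q).factorial : ℝ) = n.factorial * ((n + q).descFactorial q : ℝ) := by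
    rw [← Nat.factorial_mul_descFactorial (Nat.le_add_left q n)]
    simp
  have hnf : (0 : ℝ) < n.factorial := by exact_mod_cast n.factorial_pos
  rw [Stirling.stirlingSeq, Stirling.stirlingSeq, hfac, Real.sqrt_mul (by norm_num),
    Real.sqrt_mul (by norm_num), div_le_div_iff₀ (by positivity) (by positivity)] at hS
  rw [Real.sqrt_div hM0.le, le_div_iff₀ (Real.sqrt_pos.2 hn0)]
  set M : ℝ := ((n + q : ℕ) : ℝ) with hM
  have e1 : Real.exp q = Real.exp 1 ^ (n + q) / Real.exp 1 ^ n := by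
    rw [← Real.exp_nat_mul, ← Real.exp_nat_mul, ← Real.exp_sub]; push_cast; congr 1; ring
  have hs2 : (0 : ℝ) < Real.sqrt 2 := by positivity
  have hpos : 0 < (n.factorial : ℝ) * Real.sqrt 2 * (M / Real.exp 1) ^ (n + q) := by positivity
  refine le_of_mul_le_mul_left ?_ hpos
  calc _ = n.factorial * ((n + q).descFactorial q : ℝ) *
      (Real.sqrt 2 * Real.sqrt n * (n / Real.exp 1) ^ n) := by
        rw [e1, div_pow, div_pow, div_pow, pow_add M]
        field_simp
    _ ≤ _ := hS
    _ = _ := by ring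

/-- The Stirling ratio bound started from 1; it serves the case n = 0 below, where √(M / n) is not
available. -/
theorem factorial_mul_exp_le {M : ℕ} (hM : 1 ≤ M) :
    (M.factorial : ℝ) / (M : ℝ) ^ M * Real.exp M ≤ Real.exp 1 * Real.sqrt M := by
  have h := descFactorial_mul_exp_le le_rfl (M - 1)
  rw [Nat.add_sub_cancel' hM] at h
  have h1 : M.descFactorial (M - 1) = M.factorial := by
    have := Nat.factorial_mul_descFactorial (Nat.sub_le M 1)
    rw [Nat.sub_sub_self hM] at this
    simpa using this
  have h2 : (M : ℝ) ^ M = M ^ (M - 1) * M := by rw [← pow_succ, Nat.sub_add_cancel hM]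
  have h3 : Real.exp M = Real.exp 1 * Real.exp ((M - 1 : ℕ) : ℝ) := by
    rw [← Real.exp_add]; push_cast [hM]; congr 1; ring
  rw [h1] at h
  have hM0 : (0 : ℝ) < M := by exact_mod_cast hM
  calc _ = Real.exp 1 * ((M.factorial : ℝ) / M ^ (M - 1) * ((1 : ℕ) / (M : ℝ)) ^ 1 *
      Real.exp ((M - 1 : ℕ) : ℝ)) := by
        rw [h2, h3]; push_cast; field_simp
    _ ≤ _ := by
        gcongr
        simpa using h

/-- With s = √r, M = n + s² + 1 and z = 3(s + 1)² / (3n + 2(s + 1)), this is M³ ≤ (1 + z + z²/2 +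
z³/6)(M - (s - 1))² n cleared of denominators. Shifting s by 3/2 (below √3) and n by 1 leaves only
nonnegative coefficients. -/
theorem left_polynomial_bound {s n : ℝ} (hs : 3 / 2 ≤ s) (hn : 1 ≤ n) :
    6 * (3 * n + 2 * (s + 1)) ^ 3 * (n + s ^ 2 + 1) ^ 3 ≤
      (6 * (3 * n + 2 * (s + 1)) ^ 3 + 6 * (3 * (s + 1) ^ 2) * (3 * n + 2 * (s + 1)) ^ 2 +
        3 * (3 * (s + 1) ^ 2) ^ 2 * (3 * n + 2 * (s + 1)) + (3 * (s + 1) ^ 2) ^ 3) *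
          (n + s ^ 2 + 1 - (s - 1)) ^ 2 * n := by
  obtain ⟨a, rfl⟩ : ∃ a, s = a + 3 / 2 := ⟨s - 3 / 2, by ring⟩
  obtain ⟨b, rfl⟩ : ∃ b, n = b + 1 := ⟨n - 1, by ring⟩
  have ha : 0 ≤ a := by linarith
  have hb : 0 ≤ b := by linarith
  rw [← sub_nonneg]
  ring_nf
  positivity

theorem right_polynomial_bound {s n : ℝ} (hs : 3 / 2 ≤ s) (hn : 1 ≤ n) :
    2 * (3 * n - 2 * (s - 1)) ^ 2 * (n + s ^ 2 + 2) ^ 5 * s ^ 4 ≤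
      (2 * (3 * n - 2 * (s - 1)) ^ 2 + 2 * (3 * n - 2 * (s - 1)) * (3 * (s - 1) ^ 2) +
        (3 * (s - 1) ^ 2) ^ 2) * ((n + s ^ 2 + 2) * s ^ 2 + (s ^ 2 + s + 1) * (s + 2)) ^ 2 *
          (n + s ^ 2 + 1) ^ 2 * n := by
  obtain ⟨a, rfl⟩ : ∃ a, s = a + 3 / 2 := ⟨s - 3 / 2, by ring⟩
  obtain ⟨b, rfl⟩ : ∃ b, n = b + 1 := ⟨n - 1, by ring⟩
  have ha : 0 ≤ a := by linarith
  have hb : 0 ≤ b := by linarith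
  rw [← sub_nonneg]
  ring_nf
  positivity

/-- The case w = √r + 1, where (1 - 1/√r)(w - 1) = √r - 1. For n ≥ 1 the Stirling factor √(M / n) is
beaten by the decay exp(-z / 2) from the logarithm bound; squaring and bounding exp z below by its
cubic Taylor polynomial leaves a polynomial inequality. -/
theorem left_density_bound_endpoint {r : ℕ} (hr : 3 ≤ r) (n : ℕ) :
    ((n + (r + 1)).descFactorial (r + 1) : ℝ) / ((n + (r + 1) : ℕ) : ℝ) ^ (r + 1) *
      ((n + (Real.sqrt r + 1)) / ((n + (r + 1) : ℕ) : ℝ)) ^ n *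
        Real.exp (r + 1 - (Real.sqrt r + 1)) ≤
      1 - (Real.sqrt r - 1) / ((n + (r + 1) : ℕ) : ℝ) := by
  set s := Real.sqrt r with hs
  have hr3 : (3 : ℝ) ≤ r := by exact_mod_cast hr
  have hs2 : s ^ 2 = r := Real.sq_sqrt (by linarith)
  have hs0 : 0 ≤ s := Real.sqrt_nonneg _
  have hs1 : 3 / 2 ≤ s := by nlinarith
  set M : ℝ := ((n + (r + 1) : ℕ) : ℝ) with hM
  have hMv : M = n + s ^ 2 + 1 := by rw [hM, hs2]; push_cast; ring
  have hn0 : (0 : ℝ) ≤ n := n.cast_nonneg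
  have hM0 : 0 < M := by rw [hMv]; positivity
  have hρ : 1 - (s - 1) / M = (M - (s - 1)) / M := by field_simp
  have hMs : 0 < M - (s - 1) := by rw [hMv]; nlinarith
  rcases Nat.eq_zero_or_pos n with rfl | hn
  · have h := factorial_mul_exp_le (M := r + 1) (by omega)
    have hMr : M = ((r + 1 : ℕ) : ℝ) := by rw [hM, Nat.zero_add]
    have hd : ((0 + (r + 1)).descFactorial (r + 1) : ℝ) = (r + 1).factorial := by
      rw [Nat.zero_add, Nat.descFactorial_self]
    rw [hd, pow_zero, mul_one, hρ, le_div_iff₀ hM0]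
    rw [← hMr] at h
    have hMe : M = r + 1 := by rw [hMr]; push_cast; ring
    have e1 : Real.exp (r + 1 - (s + 1)) = Real.exp M * Real.exp (-(s + 1)) := by
      rw [← Real.exp_add, hMe]; congr 1
    have e2 : Real.exp (-(s + 1)) * Real.exp 1 = Real.exp (-s) := by
      rw [← Real.exp_add]; congr 1; ring
    have h1 : ((r + 1).factorial : ℝ) / M ^ (r + 1) * Real.exp (r + 1 - (s + 1)) ≤
        Real.sqrt M * Real.exp (-s) := by
      calc _ = ((r + 1).factorial : ℝ) / M ^ (r + 1) * Real.exp M * Real.exp (-(s + 1)) := by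
            rw [e1]; ring
        _ ≤ Real.exp 1 * Real.sqrt M * Real.exp (-(s + 1)) := by gcongr
        _ = _ := by rw [← e2]; ring
    have h2 : Real.sqrt M ≤ s + 1 := by
      rw [Real.sqrt_le_left (by linarith), hMe, ← hs2]; nlinarith
    have h3 : 1 + s + s ^ 2 / 2 ≤ Real.exp s := Real.quadratic_le_exp_of_nonneg hs0
    have h4 : (s + 1) * M ≤ (M - (s - 1)) * (1 + s + s ^ 2 / 2) := by
      rw [hMe, ← hs2]
      obtain ⟨a, ha⟩ : ∃ a, s = a + 3 / 2 := ⟨s - 3 / 2, by ring⟩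
      have ha0 : 0 ≤ a := by linarith
      rw [ha, ← sub_nonneg]
      ring_nf
      positivity
    calc _ ≤ Real.sqrt M * Real.exp (-s) * M := by gcongr
      _ ≤ (s + 1) * Real.exp (-s) * M := by gcongr
      _ = (s + 1) * M * Real.exp (-s) := by ring
      _ ≤ (M - (s - 1)) * (1 + s + s ^ 2 / 2) * Real.exp (-s) := by gcongr
      _ ≤ (M - (s - 1)) * Real.exp s * Real.exp (-s) := by gcongr
      _ = _ := by rw [mul_assoc, ← Real.exp_add]; simp
  · have hn1 : (1 : ℝ) ≤ n := by exact_mod_cast hn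
    have hnp : (0 : ℝ) < n := by linarith
    have h := descFactorial_mul_exp_le hn (r + 1)
    rw [← hM] at h
    have h1 := one_add_div_pow_mul_exp_le hn (w := s + 1) (by linarith)
    set D : ℝ := ((n + (r + 1)).descFactorial (r + 1) : ℝ) / M ^ (r + 1) with hD
    set z : ℝ := 3 * (s + 1) ^ 2 / (3 * n + 2 * (s + 1)) with hz
    have hz0 : 0 ≤ z := by positivity
    have hz2 : 3 * (s + 1) ^ 2 / (6 * n + 4 * (s + 1)) = z / 2 := by
      rw [hz]; field_simp; ring
    rw [hz2] at h1
    have h2 : D * ((n + (s + 1)) / M) ^ n * Real.exp (r + 1 - (s + 1)) ≤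
        Real.sqrt (M / n) * Real.exp (-(z / 2)) := by
      calc _ = (D * (n / M) ^ n * Real.exp ((r + 1 : ℕ) : ℝ)) *
            (((n + (s + 1)) / n) ^ n * Real.exp (-(s + 1))) := by
            have e1 : Real.exp (r + 1 - (s + 1)) =
                Real.exp ((r + 1 : ℕ) : ℝ) * Real.exp (-(s + 1)) := by
              rw [← Real.exp_add]; push_cast; congr 1
            have e2 : (n + (s + 1)) / M = n / M * ((n + (s + 1)) / n) := by field_simp
            rw [e1, e2, mul_pow]; ring
        _ ≤ _ := by gcongr
    refine h2.trans ?_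
    rw [hρ]
    refine le_of_sq_le_sq ?_ (by positivity)
    have e3 : Real.exp (-(z / 2)) ^ 2 = (Real.exp z)⁻¹ := by
      rw [← Real.exp_nat_mul, ← Real.exp_neg]; congr 1; push_cast; ring
    rw [mul_pow, Real.sq_sqrt (by positivity), e3, div_pow, ← div_eq_mul_inv, div_div,
      div_le_div_iff₀ (by positivity) (by positivity)]
    have hpoly := left_polynomial_bound hs1 hn1
    rw [← hMv] at hpoly
    have hDn : (0 : ℝ) < 3 * n + 2 * (s + 1) := by positivity
    have h5 : M ^ 3 ≤ (1 + z + z ^ 2 / 2 + z ^ 3 / 6) * (M - (s - 1)) ^ 2 * n := by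
      refine le_of_mul_le_mul_left ?_ (by positivity : 0 < 6 * (3 * (n : ℝ) + 2 * (s + 1)) ^ 3)
      refine hpoly.trans (le_of_eq ?_)
      rw [hz]; field_simp; ring
    calc M * M ^ 2 = M ^ 3 := by ring
      _ ≤ (1 + z + z ^ 2 / 2 + z ^ 3 / 6) * (M - (s - 1)) ^ 2 * n := h5
      _ ≤ Real.exp z * (M - (s - 1)) ^ 2 * n := by
          gcongr
          exact one_add_cubic_le_exp hz0
      _ = _ := by ring

/-- Raising w by δ above √r + 1 multiplies the left side by at most exp(-x) ≤ 1 / (1 + x), with x =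
(√r + 1)δ / (n + √r + 1). Up to w = r + 1 this outweighs the linear decrease of the right side, so
the endpoint case suffices. -/
theorem left_density_bound {r : ℕ} (hr : 3 ≤ r) (n : ℕ) {w : ℝ} (hw : Real.sqrt r + 1 ≤ w)
    (hwr : w ≤ r + 1) :
    ((n + (r + 1)).descFactorial (r + 1) : ℝ) / ((n + (r + 1) : ℕ) : ℝ) ^ (r + 1) *
      ((n + w) / ((n + (r + 1) : ℕ) : ℝ)) ^ n * Real.exp (r + 1 - w) ≤
      1 - (1 - 1 / Real.sqrt r) * (w - 1) / ((n + (r + 1) : ℕ) : ℝ) := by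
  have h0 := left_density_bound_endpoint hr n
  set s := Real.sqrt r with hs
  have hr3 : (3 : ℝ) ≤ r := by exact_mod_cast hr
  have hs2 : s ^ 2 = r := Real.sq_sqrt (by linarith)
  have hs0 : 0 ≤ s := Real.sqrt_nonneg _
  have hs1 : 3 / 2 ≤ s := by nlinarith
  set M : ℝ := ((n + (r + 1) : ℕ) : ℝ) with hM
  have hMv : M = n + s ^ 2 + 1 := by rw [hM, hs2]; push_cast; ring
  have hn0 : (0 : ℝ) ≤ n := n.cast_nonneg
  have hM0 : 0 < M := by rw [hMv]; positivity
  set D : ℝ := ((n + (r + 1)).descFactorial (r + 1) : ℝ) / M ^ (r + 1) with hD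
  obtain ⟨δ, hδ⟩ : ∃ δ, w = s + 1 + δ := ⟨w - (s + 1), by ring⟩
  have hδ0 : 0 ≤ δ := by linarith
  have hq : 0 < n + (s + 1) := by positivity
  set x : ℝ := (s + 1) * δ / (n + (s + 1)) with hx
  have hx0 : 0 ≤ x := by positivity
  have h1 : ((n + w) / M) ^ n * Real.exp (r + 1 - w) ≤
      ((n + (s + 1)) / M) ^ n * Real.exp (r + 1 - (s + 1)) * Real.exp (-x) := by
    have e1 : (n + w) / M = (n + (s + 1)) / M * (1 + δ / (n + (s + 1))) := by
      rw [hδ]; field_simp; ring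
    have e2 : (1 + δ / (n + (s + 1))) ^ n ≤ Real.exp (n * (δ / (n + (s + 1)))) := by
      rw [Real.exp_nat_mul]
      refine pow_le_pow_left₀ (by positivity) ?_ n
      rw [add_comm]; exact Real.add_one_le_exp _
    have e3 : Real.exp (r + 1 - (s + 1)) * Real.exp (-x) =
        Real.exp (n * (δ / (n + (s + 1)))) * Real.exp (r + 1 - w) := by
      rw [← Real.exp_add, ← Real.exp_add]
      congr 1
      rw [hx, hδ]; field_simp; ring
    calc _ = ((n + (s + 1)) / M) ^ n * ((1 + δ / (n + (s + 1))) ^ n * Real.exp (r + 1 - w)) := by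
          rw [e1, mul_pow]; ring
      _ ≤ ((n + (s + 1)) / M) ^ n *
          (Real.exp (n * (δ / (n + (s + 1)))) * Real.exp (r + 1 - w)) := by gcongr
      _ = _ := by rw [← e3]; ring
  have h2 : Real.exp (-x) ≤ 1 / (1 + x) := by
    rw [Real.exp_neg, ← one_div]
    exact one_div_le_one_div_of_le (by positivity) (by linarith [Real.add_one_le_exp x])
  have hMs : 0 < 1 - (s - 1) / M := by
    rw [sub_pos, div_lt_one hM0, hMv]; nlinarith
  calc _ = D * (((n + w) / M) ^ n * Real.exp (r + 1 - w)) := by ring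
    _ ≤ D * (((n + (s + 1)) / M) ^ n * Real.exp (r + 1 - (s + 1)) * Real.exp (-x)) := by gcongr
    _ = (D * ((n + (s + 1)) / M) ^ n * Real.exp (r + 1 - (s + 1))) * Real.exp (-x) := by ring
    _ ≤ (1 - (s - 1) / M) * (1 / (1 + x)) := by gcongr
    _ ≤ _ := by
      rw [mul_one_div, div_le_iff₀ (by positivity)]
      have hs3 : s ≠ 0 := by linarith
      have e4 : 1 - (1 - 1 / s) * (w - 1) / M = 1 - (s - 1) / M - (s - 1) * δ / (s * M) := by
        rw [hδ]; field_simp; ring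
      rw [e4, ← sub_nonneg]
      have e5 : (1 - (s - 1) / M - (s - 1) * δ / (s * M)) * (1 + x) - (1 - (s - 1) / M) =
          δ * ((s + 1) * s * (M - (s - 1)) - (s - 1) * (n + (s + 1) + (s + 1) * δ)) /
            (s * M * (n + (s + 1))) := by
        rw [hx]; field_simp; ring
      rw [e5]
      have hδ1 : δ ≤ s ^ 2 - s := by rw [hs2]; linarith
      have e6 : (s - 1) * (n + (s + 1) + (s + 1) * δ) ≤
          (s - 1) * (n + (s + 1) + (s + 1) * (s ^ 2 - s)) := by
        have : 0 ≤ s - 1 := by linarith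
        gcongr
      have e7 : (s - 1) * (n + (s + 1) + (s + 1) * (s ^ 2 - s)) ≤
          (s + 1) * s * (M - (s - 1)) := by
        rw [hMv]
        obtain ⟨a, ha⟩ : ∃ a, s = a + 3 / 2 := ⟨s - 3 / 2, by ring⟩
        have ha0 : 0 ≤ a := by linarith
        rw [ha, ← sub_nonneg]
        ring_nf
        positivity
      have e8 : 0 ≤ (s + 1) * s * (M - (s - 1)) - (s - 1) * (n + (s + 1) + (s + 1) * δ) := by
        linarith
      positivity

theorem right_density_bound_endpoint {r : ℕ} (hr : 3 ≤ r) {n : ℕ} (hn : 1 ≤ n)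
    (hwn : Real.sqrt r - 1 < n) :
    ((n + (r + 2)).descFactorial (r + 2) : ℝ) / ((n + (r + 2) : ℕ) : ℝ) ^ (r + 2) *
      (((n + (r + 2) : ℕ) : ℝ) / (((n + (r + 2) : ℕ) : ℝ) - 1)) *
      ((n - (Real.sqrt r - 1)) / ((n + (r + 2) : ℕ) : ℝ)) ^ n *
        Real.exp (r + 2 + (Real.sqrt r - 1)) ≤
      1 + (r + Real.sqrt r + 1) * (Real.sqrt r + 2) / (r * ((n + (r + 2) : ℕ) : ℝ)) := by
  set s := Real.sqrt r with hs
  have hr3 : (3 : ℝ) ≤ r := by exact_mod_cast hr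
  have hs2 : s ^ 2 = r := Real.sq_sqrt (by linarith)
  have hs0 : 0 ≤ s := Real.sqrt_nonneg _
  have hs1 : 3 / 2 ≤ s := by nlinarith
  have hsp : 0 < s := by linarith
  set M : ℝ := ((n + (r + 2) : ℕ) : ℝ) with hM
  have hMv : M = n + s ^ 2 + 2 := by rw [hM, hs2]; push_cast; ring
  have hn1 : (1 : ℝ) ≤ n := by exact_mod_cast hn
  have hnp : (0 : ℝ) < n := by linarith
  have hM0 : 0 < M := by rw [hMv]; positivity
  have hM1v : M - 1 = n + s ^ 2 + 1 := by rw [hMv]; ring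
  have hM1 : 0 < M - 1 := by rw [hM1v]; positivity
  have h := descFactorial_mul_exp_le hn (r + 2)
  rw [← hM] at h
  have h1 := one_add_div_pow_mul_exp_le hn (w := -(s - 1)) (by linarith)
  rw [← sub_eq_add_neg, neg_neg] at h1
  set D : ℝ := ((n + (r + 2)).descFactorial (r + 2) : ℝ) / M ^ (r + 2) with hD
  have hDn : (0 : ℝ) < 3 * n - 2 * (s - 1) := by linarith
  set z : ℝ := 3 * (s - 1) ^ 2 / (3 * n - 2 * (s - 1)) with hz
  have hz0 : 0 ≤ z := by positivity
  have hz2 : 3 * (-(s - 1)) ^ 2 / (6 * n + 4 * (-(s - 1))) = z / 2 := by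
    rw [hz, neg_sq, div_div]; congr 1; ring
  rw [hz2] at h1
  have h2 : D * (M / (M - 1)) * ((n - (s - 1)) / M) ^ n * Real.exp (r + 2 + (s - 1)) ≤
      Real.sqrt (M / n) * Real.exp (-(z / 2)) * (M / (M - 1)) := by
    calc _ = (D * (n / M) ^ n * Real.exp ((r + 2 : ℕ) : ℝ)) *
          (((n - (s - 1)) / n) ^ n * Real.exp (s - 1)) * (M / (M - 1)) := by
          have e1 : Real.exp (r + 2 + (s - 1)) =
              Real.exp ((r + 2 : ℕ) : ℝ) * Real.exp (s - 1) := by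
            rw [← Real.exp_add]; push_cast; congr 1
          have e2 : (n - (s - 1)) / M = n / M * ((n - (s - 1)) / n) := by field_simp
          rw [e1, e2, mul_pow]; ring
      _ ≤ _ := by
          have h3 : (0 : ℝ) < n - (s - 1) := by linarith
          gcongr
  refine h2.trans ?_
  have e4 : 1 + (r + s + 1) * (s + 2) / (r * M) =
      (M * s ^ 2 + (s ^ 2 + s + 1) * (s + 2)) / (s ^ 2 * M) := by
    rw [← hs2]; field_simp
  rw [e4]
  refine le_of_sq_le_sq ?_ (by positivity)
  have e3 : Real.exp (-(z / 2)) ^ 2 = (Real.exp z)⁻¹ := by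
    rw [← Real.exp_nat_mul, ← Real.exp_neg]; congr 1; push_cast; ring
  have e5 : (Real.sqrt (M / n) * Real.exp (-(z / 2)) * (M / (M - 1))) ^ 2 =
      M ^ 3 / (n * Real.exp z * (M - 1) ^ 2) := by
    rw [mul_pow, mul_pow, Real.sq_sqrt (by positivity), e3]; field_simp
  rw [e5, div_pow, div_le_div_iff₀ (by positivity) (by positivity)]
  have hpoly := right_polynomial_bound hs1 hn1
  rw [← hMv, ← hM1v] at hpoly
  set A : ℝ := M * s ^ 2 + (s ^ 2 + s + 1) * (s + 2) with hA
  have h5 : M ^ 5 * s ^ 4 ≤ (1 + z + z ^ 2 / 2) * A ^ 2 * (M - 1) ^ 2 * n := by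
    refine le_of_mul_le_mul_left ?_ (by positivity : 0 < 2 * (3 * (n : ℝ) - 2 * (s - 1)) ^ 2)
    calc _ = 2 * (3 * (n : ℝ) - 2 * (s - 1)) ^ 2 * M ^ 5 * s ^ 4 := by ring
      _ ≤ _ := hpoly
      _ = _ := by rw [hz]; field_simp
  calc M ^ 3 * (s ^ 2 * M) ^ 2 = M ^ 5 * s ^ 4 := by ring
    _ ≤ (1 + z + z ^ 2 / 2) * A ^ 2 * (M - 1) ^ 2 * n := h5
    _ ≤ Real.exp z * A ^ 2 * (M - 1) ^ 2 * n := by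
        gcongr
        exact Real.quadratic_le_exp_of_nonneg hz0
    _ = _ := by ring

/-- As v grows the left side decreases and (v + 3) / (r + 2 + v) increases, so only v = √r - 1
matters. -/
theorem right_density_bound {r : ℕ} (hr : 3 ≤ r) (n : ℕ) {v : ℝ} (hv : Real.sqrt r - 1 ≤ v)
    (hvn : v < n) :
    ((n + (r + 2)).descFactorial (r + 2) : ℝ) / ((n + (r + 2) : ℕ) : ℝ) ^ (r + 2) *
      (((n + (r + 2) : ℕ) : ℝ) / (((n + (r + 2) : ℕ) : ℝ) - 1)) *
      ((n - v) / ((n + (r + 2) : ℕ) : ℝ)) ^ n * Real.exp (r + 2 + v) ≤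
      1 + (r + Real.sqrt r + 1) ^ 2 / (r * ((n + (r + 2) : ℕ) : ℝ)) *
        ((v + 3) / (r + 2 + v)) := by
  have hr3 : (3 : ℝ) ≤ r := by exact_mod_cast hr
  have hs2 : Real.sqrt r ^ 2 = r := Real.sq_sqrt (by linarith)
  have hs0 : 0 ≤ Real.sqrt r := Real.sqrt_nonneg _
  have hs1 : 3 / 2 ≤ Real.sqrt r := by nlinarith
  have hn0 : (0 : ℝ) < n := by linarith
  have h0 := right_density_bound_endpoint hr (by exact_mod_cast hn0) (by linarith : √r - 1 < n)
  set s := Real.sqrt r with hs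
  set M : ℝ := ((n + (r + 2) : ℕ) : ℝ) with hM
  have hMv : M = n + s ^ 2 + 2 := by rw [hM, hs2]; push_cast; ring
  have hM0 : 0 < M := by rw [hMv]; positivity
  have hM1 : 0 < M - 1 := by
    have : M - 1 = n + s ^ 2 + 1 := by rw [hMv]; ring
    rw [this]; positivity
  set D : ℝ := ((n + (r + 2)).descFactorial (r + 2) : ℝ) / M ^ (r + 2) * (M / (M - 1)) with hD
  have hD0 : 0 ≤ D := by positivity
  have hws : 0 < n - (s - 1) := by linarith
  have hvs : 0 < n - v := by linarith
  have h1 : ((n - v) / M) ^ n * Real.exp (r + 2 + v) ≤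
      ((n - (s - 1)) / M) ^ n * Real.exp (r + 2 + (s - 1)) := by
    set t := (v - (s - 1)) / (n - (s - 1)) with ht
    have e1 : (n - v) / M = (n - (s - 1)) / M * (1 - t) := by
      rw [ht]; field_simp; ring
    have ht1 : 0 ≤ 1 - t := by
      rw [sub_nonneg, ht, div_le_one hws]; linarith
    have e2 : (1 - t) ^ n ≤ Real.exp (-(v - (s - 1))) := by
      calc (1 - t) ^ n ≤ Real.exp (-t) ^ n :=
            pow_le_pow_left₀ ht1 (Real.one_sub_le_exp_neg t) n
        _ = Real.exp (-(n * t)) := by rw [← Real.exp_nat_mul]; congr 1; ring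
        _ ≤ _ := by
            rw [Real.exp_le_exp, neg_le_neg_iff, ht, mul_div_assoc', le_div_iff₀ hws]
            nlinarith
    calc _ = ((n - (s - 1)) / M) ^ n * ((1 - t) ^ n * Real.exp (r + 2 + v)) := by
          rw [e1, mul_pow]; ring
      _ ≤ ((n - (s - 1)) / M) ^ n * (Real.exp (-(v - (s - 1))) * Real.exp (r + 2 + v)) := by
          gcongr
      _ = _ := by rw [← Real.exp_add]; congr 2; ring
  have h2 : (r + s + 1) * (s + 2) / (r * M) ≤
      (r + s + 1) ^ 2 / (r * M) * ((v + 3) / (r + 2 + v)) := by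
    have hr0 : (0 : ℝ) < r := by linarith
    have hv0 : 0 ≤ v := by linarith
    rw [div_mul_div_comm, div_le_div_iff₀ (by positivity) (by positivity)]
    have h3 : (s + 2) * (r + 2 + v) ≤ (r + s + 1) * (v + 3) := by
      nlinarith
    have h4 := mul_le_mul_of_nonneg_left h3 (by positivity : 0 ≤ (r + s + 1) * (r * M))
    linarith
  calc _ = D * (((n - v) / M) ^ n * Real.exp (r + 2 + v)) := by ring
    _ ≤ D * (((n - (s - 1)) / M) ^ n * Real.exp (r + 2 + (s - 1))) := by gcongr
    _ = D * ((n - (s - 1)) / M) ^ n * Real.exp (r + 2 + (s - 1)) := by ring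
    _ ≤ _ := h0.trans (by linarith)

/-! ### Distribution functions of N and of the gamma law -/

/-- The probability that at most `m` trials are needed. -/
noncomputable def trialsCDF (r : ℕ) (p : ℝ) (m : ℕ) : ℝ :=
  ∑ n ∈ Finset.Icc r m, trialsPMF r p n

theorem trialsPMF_nonneg (r n : ℕ) {p : ℝ} (hp : p ∈ Icc (0 : ℝ) 1) : 0 ≤ trialsPMF r p n := by
  have h0 := hp.1
  have h1 : 0 ≤ 1 - p := by linarith [hp.2]
  unfold trialsPMF
  positivity

/-- The derivative in p is a beta density: in the sum the derivatives telescope, each new term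
replacing the density for j by the one for j + 1. -/
theorem hasDerivAt_trialsCDF {r : ℕ} (hr : 1 ≤ r) (j : ℕ) (p : ℝ) :
    HasDerivAt (fun p => trialsCDF r p (r + j))
      (((r + j).descFactorial r : ℝ) / ((r - 1).factorial : ℝ) * p ^ (r - 1) * (1 - p) ^ j) p := by
  obtain ⟨k, rfl⟩ := Nat.exists_eq_add_of_le' hr
  simp only [Nat.add_sub_cancel]
  induction j with
  | zero =>
    have h : ∀ p, trialsCDF (k + 1) p (k + 1 + 0) = p ^ (k + 1) := by
      intro p
      simp [trialsCDF, trialsPMF, Nat.descFactorial_self, Nat.factorial_ne_zero]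
    simp only [h]
    refine (hasDerivAt_pow (k + 1) p).congr_deriv ?_
    rw [add_zero, Nat.descFactorial_self, Nat.factorial_succ]
    have : (k.factorial : ℝ) ≠ 0 := by exact_mod_cast k.factorial_ne_zero
    push_cast
    field_simp
  | succ j ih =>
    have h : ∀ p, trialsCDF (k + 1) p (k + 1 + (j + 1)) = trialsCDF (k + 1) p (k + 1 + j) +
        ((k + 1 + j).descFactorial k : ℝ) / (k.factorial : ℝ) * (p ^ (k + 1) * (1 - p) ^ (j + 1)) := by
      intro p
      rw [trialsCDF, ← add_assoc, Finset.sum_Icc_succ_top (by omega), trialsCDF, trialsPMF]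
      have e : k + 1 + j + 1 - (k + 1) = j + 1 := by omega
      rw [e]
      simp only [Nat.add_sub_cancel]
      ring
    simp only [h]
    have h1 : HasDerivAt (fun p : ℝ => (1 - p) ^ (j + 1)) (-((j + 1) * (1 - p) ^ j)) p := by
      have := ((hasDerivAt_id p).const_sub 1).pow (j + 1)
      refine this.congr_deriv ?_
      simp
    refine (ih.add (((hasDerivAt_pow (k + 1) p).mul h1).const_mul _)).congr_deriv ?_
    have e1 : (k + 1 + j).descFactorial (k + 1) = (j + 1) * (k + 1 + j).descFactorial k := by
      rw [Nat.descFactorial_succ]; congr 1; omega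
    have e2 : (k + 1 + (j + 1)).descFactorial (k + 1) =
        (k + 1 + j + 1) * (k + 1 + j).descFactorial k := by
      rw [← add_assoc, Nat.succ_descFactorial_succ]
    rw [e1, e2]
    push_cast
    ring

theorem trialsCDF_zero {r : ℕ} (hr : 1 ≤ r) (m : ℕ) : trialsCDF r 0 m = 0 := by
  refine Finset.sum_eq_zero fun n _ => ?_
  simp [trialsPMF, show r ≠ 0 by omega]

theorem trialsCDF_one {r : ℕ} (j : ℕ) : trialsCDF r 1 (r + j) = 1 := by
  rw [trialsCDF, Finset.sum_eq_single r]
  · simp [trialsPMF, Nat.descFactorial_self, Nat.factorial_ne_zero]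
  · intro n hn hnr
    have := (Finset.mem_Icc.1 hn).1
    simp [trialsPMF, show n - r ≠ 0 by omega]
  · intro h
    exact absurd (Finset.mem_Icc.2 ⟨le_rfl, by omega⟩) h

/-- The distribution function increases in p and equals 1 at p = 1. No evaluation of the full series
is needed, since only total mass at most 1 is used later. -/
theorem trialsCDF_le_one {r : ℕ} (hr : 1 ≤ r) (m : ℕ) {p : ℝ} (hp : p ∈ Icc (0 : ℝ) 1) :
    trialsCDF r p m ≤ 1 := by
  rcases lt_or_ge m r with h | h
  · rw [trialsCDF, Finset.Icc_eq_empty (by omega)]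
    simp
  obtain ⟨j, rfl⟩ := Nat.exists_eq_add_of_le h
  rw [← trialsCDF_one (r := r) j]
  refine monotoneOn_of_deriv_nonneg (convex_Icc (0 : ℝ) 1)
    (fun q _ => (hasDerivAt_trialsCDF hr j q).continuousAt.continuousWithinAt)
    (fun q _ => (hasDerivAt_trialsCDF hr j q).differentiableAt.differentiableWithinAt)
    (fun q hq => ?_) hp (right_mem_Icc.2 zero_le_one) hp.2
  rw [interior_Icc] at hq
  rw [(hasDerivAt_trialsCDF hr j q).deriv]
  have h0 := hq.1.le
  have h1 : 0 ≤ 1 - q := by linarith [hq.2]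
  positivity

theorem phi_nonneg (r : ℕ) {x : ℝ} (hx : 0 ≤ x) : 0 ≤ phi r x := by
  unfold phi; positivity

theorem continuous_phi (r : ℕ) : Continuous (phi r) := by
  unfold phi; fun_prop

theorem hasDerivAt_mul_phi {r : ℕ} (hr : 1 ≤ r) (x : ℝ) :
    HasDerivAt (fun x => x * phi r x) (phi r x * (r - x)) x := by
  obtain ⟨k, rfl⟩ := Nat.exists_eq_add_of_le' hr
  have h : ∀ x, x * phi (k + 1) x = x ^ (k + 1) * Real.exp (-x) / (k.factorial : ℝ) := by
    intro x; simp only [phi, Nat.add_sub_cancel]; ring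
  simp only [h]
  have h1 : HasDerivAt (fun x : ℝ => Real.exp (-x)) (-Real.exp (-x)) x := by
    simpa using (hasDerivAt_neg x).exp
  refine (((hasDerivAt_pow (k + 1) x).mul h1).div_const _).congr_deriv ?_
  simp only [phi, Nat.add_sub_cancel]
  push_cast
  ring

theorem hasDerivAt_phi {r : ℕ} (hr : 1 ≤ r) {x : ℝ} (hx : 0 < x) :
    HasDerivAt (phi r) (phi r x * ((r - 1) / x - 1)) x := by
  have h := (hasDerivAt_mul_phi hr x).div (hasDerivAt_id x) hx.ne'
  refine (h.congr_of_eventuallyEq ?_).congr_deriv ?_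
  · filter_upwards [eventually_ne_nhds hx.ne'] with y hy
    simp [hy]
  · simp only [id]; field_simp; ring

/-- The tail `∫_x^∞ φ` of the gamma distribution. -/
noncomputable def gammaTail (r : ℕ) (x : ℝ) : ℝ :=
  ∑ k ∈ Finset.range r, x ^ k * Real.exp (-x) / (k.factorial : ℝ)

theorem hasDerivAt_gammaTail {r : ℕ} (hr : 1 ≤ r) (x : ℝ) :
    HasDerivAt (gammaTail r) (-phi r x) x := by
  have h1 : HasDerivAt (fun x : ℝ => Real.exp (-x)) (-Real.exp (-x)) x := by
    simpa using (hasDerivAt_neg x).exp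
  induction r, hr using Nat.le_induction with
  | base =>
    have : gammaTail 1 = fun x => Real.exp (-x) := by ext x; simp [gammaTail]
    rw [this]
    simpa [phi] using h1
  | succ r hr ih =>
    have : gammaTail (r + 1) = fun x => gammaTail r x + x ^ r * Real.exp (-x) / (r.factorial : ℝ) := by
      ext x; rw [gammaTail, Finset.sum_range_succ, gammaTail]
    rw [this]
    obtain ⟨k, rfl⟩ := Nat.exists_eq_add_of_le' hr
    refine (ih.add (((hasDerivAt_pow (k + 1) x).mul h1).div_const _)).congr_deriv ?_
    simp only [phi, Nat.add_sub_cancel, Nat.factorial_succ]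
    have : (k.factorial : ℝ) ≠ 0 := by exact_mod_cast k.factorial_ne_zero
    push_cast
    field_simp
    ring

theorem gammaTail_zero {r : ℕ} (hr : 1 ≤ r) : gammaTail r 0 = 1 := by
  obtain ⟨k, rfl⟩ := Nat.exists_eq_add_of_le' hr
  rw [gammaTail, Finset.sum_range_succ', Finset.sum_eq_zero]
  · simp
  · intro i _; simp

theorem gammaTail_nonneg (r : ℕ) {x : ℝ} (hx : 0 ≤ x) : 0 ≤ gammaTail r x := by
  unfold gammaTail; positivity

theorem tendsto_gammaTail (r : ℕ) : Tendsto (gammaTail r) atTop (𝓝 0) := by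
  unfold gammaTail
  rw [← Finset.sum_const_zero (s := Finset.range r)]
  refine tendsto_finsetSum _ fun k _ => ?_
  simpa using (Real.tendsto_pow_mul_exp_neg_atTop_nhds_zero k).div_const _

/-! ### Tail comparison at the atoms, by monotonicity in p -/

theorem trialsCDF_le {r : ℕ} (hr : 3 ≤ r) (n : ℕ) {p : ℝ} (hp0 : 0 ≤ p)
    (hp : ((n + (r + 1) : ℕ) : ℝ) * p ≤ r - Real.sqrt r) :
    trialsCDF r p (r + n) ≤ 1 - gammaTail r (((n + (r + 1) : ℕ) : ℝ) * p) -
      p / r * (((n + (r + 1) : ℕ) : ℝ) * p * phi r (((n + (r + 1) : ℕ) : ℝ) * p)) := by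
  have hr1 : 1 ≤ r := by omega
  have hr3 : (3 : ℝ) ≤ r := by exact_mod_cast hr
  have hr0 : (0 : ℝ) < r := by linarith
  have hs2 : Real.sqrt r ^ 2 = r := Real.sq_sqrt (by linarith)
  have hs0 : 0 ≤ Real.sqrt r := Real.sqrt_nonneg _
  have hs1 : 3 / 2 ≤ Real.sqrt r := by nlinarith
  have hld := fun w => left_density_bound hr n (w := w)
  set s := Real.sqrt r with hs
  set M : ℝ := ((n + (r + 1) : ℕ) : ℝ) with hM
  have hMv : M = n + r + 1 := by rw [hM]; push_cast; ring
  have hM0 : 0 < M := by rw [hMv]; positivity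
  -- The varying weight p / r is replaced by the constant κ / M, which keeps the derivative of `H`
  -- simple. Since κ r = r - √r, the inequality p / r ≤ κ / M is exactly the hypothesis M p ≤ r -
  -- √r.
  set κ : ℝ := 1 - 1 / s with hκ
  have hκ0 : 0 ≤ κ := by rw [hκ, sub_nonneg, div_le_one (by linarith)]; linarith
  set H : ℝ → ℝ := fun p => 1 - gammaTail r (M * p) - κ / M * (M * p * phi r (M * p)) -
    trialsCDF r p (r + n) with hH
  have hlin : ∀ q : ℝ, HasDerivAt (fun q => M * q) M q := fun q => by
    simpa using (hasDerivAt_id q).const_mul M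
  have hd : ∀ q, HasDerivAt H (M * phi r (M * q) * (1 - κ * (r - M * q) / M) -
      (((r + n).descFactorial r : ℝ) / ((r - 1).factorial : ℝ) * q ^ (r - 1) * (1 - q) ^ n)) q := by
    intro q
    have e1 := (hasDerivAt_gammaTail hr1 (M * q)).comp q (hlin q)
    have e2 := ((hasDerivAt_mul_phi hr1 (M * q)).comp q (hlin q)).const_mul (κ / M)
    refine (((e1.const_sub 1).sub e2).sub (hasDerivAt_trialsCDF hr1 n q)).congr_deriv ?_
    field_simp
  have hH0 : H 0 = 0 := by
    simp [hH, gammaTail_zero hr1, trialsCDF_zero hr1]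
  have hHp : 0 ≤ H p := by
    rw [← hH0]
    refine monotoneOn_of_deriv_nonneg (convex_Icc (0 : ℝ) p)
      (fun q _ => (hd q).continuousAt.continuousWithinAt)
      (fun q _ => (hd q).differentiableAt.differentiableWithinAt)
      (fun q hq => ?_) (left_mem_Icc.2 hp0) (right_mem_Icc.2 hp0) hp0
    rw [interior_Icc] at hq
    rw [(hd q).deriv, sub_nonneg]
    have hq0 := hq.1.le
    have hqp : M * q ≤ M * p := by gcongr; exact hq.2.le
    -- This choice of w makes n + w = M(1 - q), so the density bound compares the beta density at q
    -- with the gamma density at M q.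
    have h1 := hld (r + 1 - M * q) (by linarith) (by linarith [mul_nonneg hM0.le hq0])
    have e1 : (n + (r + 1 - M * q)) / M = 1 - q := by
      rw [div_eq_iff hM0.ne', hMv]; ring
    have e2 : r + 1 - (r + 1 - M * q) = M * q := by ring
    have e3 : r + 1 - M * q - 1 = r - M * q := by ring
    have e4 : ((n + (r + 1)).descFactorial (r + 1) : ℝ) / M ^ (r + 1) =
        ((r + n).descFactorial r : ℝ) / M ^ r := by
      have : (n + (r + 1)).descFactorial (r + 1) = (n + (r + 1)) * (r + n).descFactorial r := by
        rw [← add_assoc, Nat.succ_descFactorial_succ, add_comm n r]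
      rw [this, Nat.cast_mul, ← hM, pow_succ]
      field_simp
    rw [e1, e2, e3, e4] at h1
    have e5 : M ^ r = M ^ (r - 1) * M := by rw [← pow_succ, Nat.sub_add_cancel hr1]
    calc _ = M * phi r (M * q) *
          (((r + n).descFactorial r : ℝ) / M ^ r * (1 - q) ^ n * Real.exp (M * q)) := by
          rw [phi, e5, mul_pow, Real.exp_neg]
          field_simp
      _ ≤ _ := by
          have := phi_nonneg r (mul_nonneg hM0.le hq0)
          gcongr
  have hfin : p / r * (M * p * phi r (M * p)) ≤ κ / M * (M * p * phi r (M * p)) := by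
    have h1 := phi_nonneg r (mul_nonneg hM0.le hp0)
    have h2 : p / r ≤ κ / M := by
      rw [div_le_div_iff₀ hr0 hM0]
      have : κ * r = r - s := by
        rw [hκ, ← hs2]; field_simp
      linarith
    gcongr
  simp only [hH] at hHp
  linarith

theorem one_sub_trialsCDF_le {r : ℕ} (hr : 3 ≤ r) (n : ℕ) {p : ℝ} (hp1 : p < 1)
    (hp : r + Real.sqrt r + 1 ≤ ((n + (r + 2) : ℕ) : ℝ) * p) :
    1 - trialsCDF r p (r + n) ≤ gammaTail r (((n + (r + 2) : ℕ) : ℝ) * p) +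
      p / r * (((n + (r + 2) : ℕ) : ℝ) * p * phi r (((n + (r + 2) : ℕ) : ℝ) * p)) := by
  have hr1 : 1 ≤ r := by omega
  have hr3 : (3 : ℝ) ≤ r := by exact_mod_cast hr
  have hr0 : (0 : ℝ) < r := by linarith
  have hs0 : 0 ≤ Real.sqrt r := Real.sqrt_nonneg _
  have hrd := fun v => right_density_bound hr n (v := v)
  set s := Real.sqrt r with hs
  set M : ℝ := ((n + (r + 2) : ℕ) : ℝ) with hM
  have hMv : M = n + r + 2 := by rw [hM]; push_cast; ring
  have hM0 : 0 < M := by rw [hMv]; positivity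
  have hMp : 0 < M * p := by linarith
  have hp0 : 0 < p := pos_of_mul_pos_right hMp hM0.le
  -- Again a constant coefficient stands in for a varying one: K / M ≤ (p / r) M p amounts to (r +
  -- √r + 1)² ≤ (M p)². This time `H` is compared with its value at p = 1, where the distribution
  -- function is 1.
  set K : ℝ := (r + s + 1) ^ 2 / r with hK
  have hK0 : 0 ≤ K := by positivity
  set H : ℝ → ℝ := fun p => gammaTail r (M * p) + K / M * phi r (M * p) - 1 +
    trialsCDF r p (r + n) with hH
  have hlin : ∀ q : ℝ, HasDerivAt (fun q => M * q) M q := fun q => by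
    simpa using (hasDerivAt_id q).const_mul M
  have hd : ∀ q, 0 < q → HasDerivAt H ((((r + n).descFactorial r : ℝ) / ((r - 1).factorial : ℝ) *
      q ^ (r - 1) * (1 - q) ^ n) -
        M * phi r (M * q) * (1 + K / M * ((M * q - r + 1) / (M * q)))) q := by
    intro q hq
    have hMq : 0 < M * q := by positivity
    have e1 := (hasDerivAt_gammaTail hr1 (M * q)).comp q (hlin q)
    have e2 := ((hasDerivAt_phi hr1 hMq).comp q (hlin q)).const_mul (K / M)
    refine (((e1.add e2).sub_const 1).add (hasDerivAt_trialsCDF hr1 n q)).congr_deriv ?_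
    field_simp
    ring
  have hH1 : 0 ≤ H 1 := by
    simp only [hH, trialsCDF_one, mul_one]
    have := phi_nonneg r hM0.le
    have := gammaTail_nonneg r hM0.le
    have : 0 ≤ K / M * phi r M := by positivity
    linarith
  have hHp : 0 ≤ H p := by
    refine hH1.trans ?_
    refine antitoneOn_of_deriv_nonpos (convex_Icc p 1)
      (fun q hq => (hd q (hp0.trans_le hq.1)).continuousAt.continuousWithinAt)
      (fun q hq => ?_) (fun q hq => ?_) (left_mem_Icc.2 hp1.le) (right_mem_Icc.2 hp1.le) hp1.le
    · rw [interior_Icc] at hq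
      exact (hd q (hp0.trans hq.1)).differentiableAt.differentiableWithinAt
    rw [interior_Icc] at hq
    have hq0 : 0 < q := hp0.trans hq.1
    rw [(hd q hq0).deriv, sub_nonpos]
    have hMq : 0 < M * q := by positivity
    have hqp : M * p ≤ M * q := by gcongr; exact hq.1.le
    have hqM : M * q < M := by nlinarith [hq.2]
    have h1 := hrd (M * q - (r + 2)) (by linarith) (by linarith)
    have e1 : (n - (M * q - (r + 2))) / M = 1 - q := by
      rw [div_eq_iff hM0.ne', hMv]; ring
    have e2 : r + 2 + (M * q - (r + 2)) = M * q := by ring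
    have e3 : M * q - (r + 2) + 3 = M * q - r + 1 := by ring
    have hM1 : 0 < M - 1 := by rw [hMv]; linarith [(n.cast_nonneg : (0 : ℝ) ≤ n)]
    have e4 : ((n + (r + 2)).descFactorial (r + 2) : ℝ) / M ^ (r + 2) * (M / (M - 1)) =
        ((r + n).descFactorial r : ℝ) / M ^ r := by
      have : (n + (r + 2)).descFactorial (r + 2) =
          (n + (r + 2)) * ((n + (r + 1)) * (r + n).descFactorial r) := by
        rw [← add_assoc, Nat.succ_descFactorial_succ, ← add_assoc n r 1,
          Nat.succ_descFactorial_succ, add_comm n r]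
      have e6 : ((n + (r + 1) : ℕ) : ℝ) = M - 1 := by rw [hMv]; push_cast; ring
      rw [this, Nat.cast_mul, Nat.cast_mul, ← hM, e6, pow_add]
      field_simp
    rw [e1, e2, e3, e4] at h1
    have e5 : M ^ r = M ^ (r - 1) * M := by rw [← pow_succ, Nat.sub_add_cancel hr1]
    have e6 : (r + s + 1) ^ 2 / (r * M) = K / M := by rw [hK, div_div]
    rw [e6] at h1
    calc _ = M * phi r (M * q) *
          (((r + n).descFactorial r : ℝ) / M ^ r * (1 - q) ^ n * Real.exp (M * q)) := by
          rw [phi, e5, mul_pow, Real.exp_neg]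
          field_simp
      _ ≤ _ := by
          have := phi_nonneg r hMq.le
          gcongr
  have hfin : K / M * phi r (M * p) ≤ p / r * (M * p * phi r (M * p)) := by
    have h1 := phi_nonneg r hMp.le
    have h2 : K / M ≤ p / r * (M * p) := by
      rw [hK, div_div, div_mul_eq_mul_div, div_le_div_iff₀ (by positivity) hr0]
      have : (r + s + 1) ^ 2 ≤ (M * p) ^ 2 := by gcongr
      nlinarith
    calc _ ≤ p / r * (M * p) * phi r (M * p) := by gcongr
      _ = _ := by ring
  simp only [hH] at hHp
  linarith

/-! ### Comparison of integrals from comparison of tails -/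

/-- A nonempty lower set lies between the open and the closed half-line ending at its supremum, and
these have equal `Q`-measure because `Q` has no atoms. -/
theorem measure_le_of_isLowerSet {P Q : Measure ℝ} [NullSingletonClass Q] {y : ℝ}
    (h : ∀ b ≤ y, P (Iic b) ≤ Q (Iic b)) {A : Set ℝ} (hA : IsLowerSet A) (hAy : A ⊆ Iic y) :
    P A ≤ Q A := by
  rcases A.eq_empty_or_nonempty with rfl | hne
  · simp
  have hbdd : BddAbove A := ⟨y, hAy⟩
  calc P A ≤ P (Iic (sSup A)) := measure_mono fun z hz => le_csSup hbdd hz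
    _ ≤ Q (Iic (sSup A)) := h _ (csSup_le hne hAy)
    _ = Q (Iio (sSup A)) := measure_congr Iio_ae_eq_Iic.symm
    _ ≤ Q A := measure_mono fun z hz => by
        obtain ⟨a, ha, hza⟩ := exists_lt_of_lt_csSup hne hz
        exact hA hza.le ha

theorem measure_le_of_isUpperSet {P Q : Measure ℝ} [NullSingletonClass Q] {x : ℝ}
    (h : ∀ b, x ≤ b → P (Ici b) ≤ Q (Ici b)) {A : Set ℝ} (hA : IsUpperSet A) (hAx : A ⊆ Ici x) :
    P A ≤ Q A := by
  rcases A.eq_empty_or_nonempty with rfl | hne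
  · simp
  have hbdd : BddBelow A := ⟨x, hAx⟩
  calc P A ≤ P (Ici (sInf A)) := measure_mono fun z hz => csInf_le hbdd hz
    _ ≤ Q (Ici (sInf A)) := h _ (le_csInf hne hAx)
    _ = Q (Ioi (sInf A)) := measure_congr Ioi_ae_eq_Ici.symm
    _ ≤ Q A := measure_mono fun z hz => by
        obtain ⟨a, ha, hza⟩ := exists_lt_of_csInf_lt hne hz
        exact hA hza.le ha

/-- A function that decreases on `(0, y]`, is constant on `[y, x]` and increases on `[x, ∞)` has the
larger integral with respect to the measure with the larger tails. -/
theorem lintegral_le_of_tails_le {P Q : Measure ℝ} [NullSingletonClass Q] (hP0 : P (Iic 0) = 0)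
    (hQ0 : Q (Iic 0) = 0) (huniv : P univ ≤ Q univ) {y x : ℝ} (hy : 0 < y) (hyx : y ≤ x)
    (hlow : ∀ b ≤ y, P (Iic b) ≤ Q (Iic b)) (hupp : ∀ b, x ≤ b → P (Ici b) ≤ Q (Ici b))
    {h : ℝ → ℝ} (hm : Measurable h) {C : ℝ} (hC : 0 ≤ C) (hconst : ∀ z ∈ Icc y x, h z = C)
    (hanti : AntitoneOn h (Ioc 0 y)) (hmono : MonotoneOn h (Ici x)) :
    ∫⁻ z, ENNReal.ofReal (h z) ∂P ≤ ∫⁻ z, ENNReal.ofReal (h z) ∂Q := by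
  have hge : ∀ z, 0 < z → C ≤ h z := by
    intro z hz
    rcases le_total z y with h1 | h1
    · rw [← hconst y ⟨le_rfl, hyx⟩]
      exact hanti ⟨hz, h1⟩ ⟨hy, le_rfl⟩ h1
    rcases le_total z x with h2 | h2
    · exact (hconst z ⟨h1, h2⟩).ge
    · rw [← hconst x ⟨hyx, le_rfl⟩]
      exact hmono (mem_Ici.2 le_rfl) h2 h2
  -- The excess over the minimum `C`, cut off on (-∞, 0], where `h` is uncontrolled and both
  -- measures vanish. By the layer-cake formula it remains to compare the measures of its superlevel
  -- sets.
  set g : ℝ → ℝ := fun z => if 0 < z then h z - C else 0 with hg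
  have hg0 : ∀ z, 0 ≤ g z := by
    intro z
    simp only [hg]
    split_ifs with hz
    · linarith [hge z hz]
    · exact le_rfl
  have hgm : Measurable g :=
    Measurable.ite measurableSet_Ioi (hm.sub_const C) measurable_const
  have hsplit : ∀ μ : Measure ℝ, μ (Iic 0) = 0 →
      ∫⁻ z, ENNReal.ofReal (h z) ∂μ = ENNReal.ofReal C * μ univ +
        ∫⁻ t in Ioi (0 : ℝ), μ {z | t < g z} := by
    intro μ hμ
    rw [← lintegral_eq_lintegral_meas_lt μ (Eventually.of_forall hg0) hgm.aemeasurable,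
      ← lintegral_const, ← lintegral_add_left measurable_const]
    have hae : ∀ᵐ z ∂μ, 0 < z := by
      rw [ae_iff]
      simpa [not_lt, Iic_def] using hμ
    refine lintegral_congr_ae ?_
    filter_upwards [hae] with z hz
    rw [← ENNReal.ofReal_add hC (hg0 z)]
    simp [hg, hz]
  rw [hsplit P hP0, hsplit Q hQ0]
  refine add_le_add (by gcongr) (lintegral_mono_ae ?_)
  filter_upwards [ae_restrict_mem measurableSet_Ioi] with t ht
  have ht0 : 0 < t := ht
  set S : Set ℝ := {z | t < g z} with hS
  have hSm : MeasurableSet S := measurableSet_lt measurable_const hgm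
  have hSpos : ∀ z ∈ S, 0 < z ∧ t < h z - C := by
    intro z hz
    have hz' : t < g z := hz
    simp only [hg] at hz'
    split_ifs at hz' with h0
    · exact ⟨h0, hz'⟩
    · exact absurd hz' (by linarith)
  have hSmem : ∀ z, 0 < z → t < h z - C → z ∈ S := by
    intro z h0 h1
    change t < g z
    simp only [hg, h0, if_true]
    exact h1
  -- Adjoining the `Q`-null half-line `Iic 0` turns the left piece of the superlevel set into a
  -- lower set.
  have h1 : P (S ∩ Iic y) ≤ Q (S ∩ Iic y) := by
    calc P (S ∩ Iic y) ≤ P ((S ∩ Iic y) ∪ Iic 0) := measure_mono subset_union_left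
      _ ≤ Q ((S ∩ Iic y) ∪ Iic 0) := by
          refine measure_le_of_isLowerSet hlow ?_ ?_
          · rintro a b hba (ha | ha)
            · rcases le_or_gt b 0 with hb | hb
              · exact Or.inr hb
              · refine Or.inl ⟨hSmem b hb ?_, hba.trans ha.2⟩
                have h2 := hanti ⟨hb, hba.trans ha.2⟩ ⟨(hSpos a ha.1).1, ha.2⟩ hba
                linarith [(hSpos a ha.1).2]
            · exact Or.inr (hba.trans ha)
          · rintro a (ha | ha)
            · exact ha.2
            · exact le_trans ha hy.le
      _ ≤ Q (S ∩ Iic y) + Q (Iic 0) := measure_union_le _ _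
      _ = _ := by rw [hQ0, add_zero]
  have hup : ∀ z ∈ S ∩ Ioi y, x < z := by
    intro z hz
    by_contra hzx
    have := (hSpos z hz.1).2
    rw [hconst z ⟨le_of_lt hz.2, not_lt.1 hzx⟩] at this
    linarith
  have h2 : P (S ∩ Ioi y) ≤ Q (S ∩ Ioi y) := by
    refine measure_le_of_isUpperSet hupp ?_ fun z hz => (hup z hz).le
    intro a b hab ha
    have hxa := hup a ha
    refine ⟨hSmem b ((hSpos a ha.1).1.trans_le hab) ?_, lt_of_lt_of_le ha.2 hab⟩
    have h3 := hmono (mem_Ici.2 hxa.le) (mem_Ici.2 (hxa.le.trans hab)) hab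
    linarith [(hSpos a ha.1).2]
  calc P S = P (S ∩ Iic y) + P (S ∩ Ioi y) := by
        rw [← measure_inter_add_sdiff S (measurableSet_Iic (a := y)), sdiff_eq, compl_Iic]
    _ ≤ Q (S ∩ Iic y) + Q (S ∩ Ioi y) := add_le_add h1 h2
    _ = Q S := by
        rw [← measure_inter_add_sdiff S (measurableSet_Iic (a := y)), sdiff_eq, compl_Iic]

/-! ### The law of (N + 1)p and the gamma mixture -/

theorem tsum_trialsPMF_mul_indicator (r m : ℕ) {p : ℝ} (hp : p ∈ Icc (0 : ℝ) 1) :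
    ∑' n : {n : ℕ // r ≤ n}, ENNReal.ofReal (trialsPMF r p n.1) * (if n.1 ≤ m then 1 else 0) =
      ENNReal.ofReal (trialsCDF r p m) := by
  have h := tsum_subtype {n : ℕ | r ≤ n}
    (fun n => ENNReal.ofReal (trialsPMF r p n) * (if n ≤ m then 1 else 0))
  refine h.trans ?_
  rw [tsum_eq_sum (s := Finset.Icc r m), trialsCDF,
    ENNReal.ofReal_sum_of_nonneg fun n _ => trialsPMF_nonneg r n hp]
  · refine Finset.sum_congr rfl fun n hn => ?_
    rw [Finset.mem_Icc] at hn
    rw [indicator_of_mem (show n ∈ {n : ℕ | r ≤ n} from hn.1), if_pos hn.2, mul_one]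
  · intro n hn
    rw [Finset.mem_Icc, not_and] at hn
    by_cases h1 : r ≤ n
    · rw [indicator_of_mem (show n ∈ {n : ℕ | r ≤ n} from h1), if_neg (hn h1), mul_zero]
    · exact indicator_of_notMem h1 _

theorem tsum_trialsPMF_le_one {r : ℕ} (hr : 1 ≤ r) {p : ℝ} (hp : p ∈ Icc (0 : ℝ) 1) :
    ∑' n : {n : ℕ // r ≤ n}, ENNReal.ofReal (trialsPMF r p n.1) ≤ 1 := by
  rw [ENNReal.tsum_eq_iSup_sum]
  refine iSup_le fun s => ?_
  set m := s.sup (fun n => n.1) with hm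
  calc ∑ n ∈ s, ENNReal.ofReal (trialsPMF r p n.1)
      = ∑ n ∈ s, ENNReal.ofReal (trialsPMF r p n.1) * (if n.1 ≤ m then 1 else 0) := by
        refine Finset.sum_congr rfl fun n hn => ?_
        rw [if_pos (Finset.le_sup (f := fun n : {n : ℕ // r ≤ n} => n.1) hn), mul_one]
    _ ≤ _ := ENNReal.sum_le_tsum s
    _ = _ := tsum_trialsPMF_mul_indicator r m hp
    _ ≤ 1 := by
        rw [← ENNReal.ofReal_one]
        exact ENNReal.ofReal_le_ofReal (trialsCDF_le_one hr m hp)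

/-- The distribution of `(N + 1) p`. -/
noncomputable def scaledTrials (r : ℕ) (p : ℝ) : Measure ℝ :=
  Measure.sum fun n : {n : ℕ // r ≤ n} =>
    ENNReal.ofReal (trialsPMF r p n.1) • Measure.dirac (((n.1 : ℝ) + 1) * p)

theorem lintegral_scaledTrials (r : ℕ) (p : ℝ) {h : ℝ → ℝ≥0∞} :
    ∫⁻ z, h z ∂scaledTrials r p = ∑' n : {n : ℕ // r ≤ n},
      ENNReal.ofReal (trialsPMF r p n.1) * h (((n.1 : ℝ) + 1) * p) := by
  rw [scaledTrials, lintegral_sum_measure]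
  simp [lintegral_smul_measure]

theorem scaledTrials_apply (r : ℕ) (p : ℝ) {s : Set ℝ} (hs : MeasurableSet s) :
    scaledTrials r p s = ∑' n : {n : ℕ // r ≤ n},
      ENNReal.ofReal (trialsPMF r p n.1) * s.indicator 1 (((n.1 : ℝ) + 1) * p) := by
  rw [← lintegral_indicator_one hs, lintegral_scaledTrials]

theorem scaledTrials_univ_le {r : ℕ} (hr : 1 ≤ r) {p : ℝ} (hp : p ∈ Icc (0 : ℝ) 1) :
    scaledTrials r p univ ≤ 1 := by
  rw [scaledTrials_apply r p MeasurableSet.univ]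
  simpa using tsum_trialsPMF_le_one hr hp

/-- The mixture of gamma distributions with shapes `r` and `r + 1` and weights `1 - p` and `p`. -/
noncomputable def gammaMixture (r : ℕ) (p : ℝ) : Measure ℝ :=
  (volume.restrict (Ioi (0 : ℝ))).withDensity
    fun x => ENNReal.ofReal (phi r x * (1 - p + p * x / r))

instance (r : ℕ) (p : ℝ) : NullSingletonClass (gammaMixture r p) := by
  unfold gammaMixture; infer_instance

theorem gammaMixture_Ioi {r : ℕ} (hr : 1 ≤ r) {p : ℝ} (hp : p ∈ Icc (0 : ℝ) 1) {x : ℝ}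
    (hx : 0 ≤ x) : gammaMixture r p (Ioi x) =
      ENNReal.ofReal (gammaTail r x + p / r * (x * phi r x)) := by
  have hr0 : (0 : ℝ) < r := by exact_mod_cast hr
  set T : ℝ → ℝ := fun x => gammaTail r x + p / r * (x * phi r x) with hT
  -- The Gamma(r + 1) density is φ(u) u / r, and its tail exceeds that of Gamma(r) by x φ(x) / r;
  -- hence `T` is minus an antiderivative of the mixture density.
  have hd : ∀ u ∈ Ici x, HasDerivAt T (-(phi r u * (1 - p + p * u / r))) u := by
    intro u _
    refine ((hasDerivAt_gammaTail hr u).add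
      ((hasDerivAt_mul_phi hr u).const_mul (p / r))).congr_deriv ?_
    field_simp
    ring
  have hnn : ∀ u, 0 < u → 0 ≤ phi r u * (1 - p + p * u / r) := by
    intro u hu
    have h1 := phi_nonneg r hu.le
    have h2 := hp.1
    have h3 : 0 ≤ 1 - p := by linarith [hp.2]
    positivity
  have hneg : ∀ u ∈ Ioi x, -(phi r u * (1 - p + p * u / r)) ≤ 0 := fun u hu => by
    linarith [hnn u (lt_of_le_of_lt hx hu)]
  have hlim : Tendsto T atTop (𝓝 0) := by
    have h1 : Tendsto (fun x => x * phi r x) atTop (𝓝 0) := by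
      have h2 : ∀ x, x * phi r x = x ^ r * Real.exp (-x) / ((r - 1).factorial : ℝ) := by
        intro x
        rw [phi, ← Nat.sub_add_cancel hr, pow_succ]
        simp only [Nat.add_sub_cancel]
        ring
      simp only [h2]
      simpa using (Real.tendsto_pow_mul_exp_neg_atTop_nhds_zero r).div_const _
    simpa using (tendsto_gammaTail r).add (h1.const_mul (p / r))
  have hint := integrableOn_Ioi_deriv_of_nonpos' hd hneg hlim
  have hval := integral_Ioi_of_hasDerivAt_of_nonpos' hd hneg hlim
  rw [gammaMixture, withDensity_apply _ measurableSet_Ioi, Measure.restrict_restrict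
    measurableSet_Ioi, inter_eq_left.2 (Ioi_subset_Ioi hx), ← ofReal_integral_eq_lintegral_ofReal]
  · rw [integral_neg] at hval
    congr 1
    linarith
  · simpa [IntegrableOn] using hint.neg
  · filter_upwards [ae_restrict_mem measurableSet_Ioi] with u hu
    exact hnn u (lt_of_le_of_lt hx hu)

theorem gammaMixture_Iic_zero (r : ℕ) (p : ℝ) : gammaMixture r p (Iic 0) = 0 := by
  rw [gammaMixture, withDensity_apply _ measurableSet_Iic,
    Measure.restrict_restrict measurableSet_Iic, Iic_inter_Ioi]
  simp

theorem gammaMixture_univ {r : ℕ} (hr : 1 ≤ r) {p : ℝ} (hp : p ∈ Icc (0 : ℝ) 1) :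
    gammaMixture r p univ = 1 := by
  rw [← measure_add_measure_compl (measurableSet_Iic (a := (0 : ℝ))), gammaMixture_Iic_zero,
    compl_Iic, gammaMixture_Ioi hr hp le_rfl, gammaTail_zero hr]
  simp

/-- The law of (N + 1)p charges only multiples of p that are at least (r + 1)p. Below that point
there is nothing to prove; otherwise y may be lowered to the largest multiple of p not above it,
with index n + r + 1 = ⌊y / p⌋. -/
theorem scaledTrials_Iic_le {r : ℕ} (hr : 3 ≤ r) {p : ℝ} (hp : p ∈ Ioo (0 : ℝ) 1) {y : ℝ}
    (hy : y ≤ r - Real.sqrt r) : scaledTrials r p (Iic y) ≤ gammaMixture r p (Iic y) := by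
  have hr1 : 1 ≤ r := by omega
  have hp' : p ∈ Icc (0 : ℝ) 1 := Ioo_subset_Icc_self hp
  have hp0 := hp.1
  rw [scaledTrials_apply r p measurableSet_Iic]
  rcases lt_or_ge y ((r + 1) * p) with h | h
  · have : ∀ n : {n : ℕ // r ≤ n}, (Iic y).indicator (1 : ℝ → ℝ≥0∞) (((n.1 : ℝ) + 1) * p) = 0 := by
      intro n
      refine indicator_of_notMem ?_ _
      rw [mem_Iic, not_le]
      refine h.trans_le ?_
      have : (r : ℝ) ≤ n.1 := by exact_mod_cast n.2
      gcongr
    simp [this]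
  have hyp : (r : ℝ) + 1 ≤ y / p := by rwa [le_div_iff₀ hp0]
  have hfl : r + 1 ≤ ⌊y / p⌋₊ := Nat.le_floor (by exact_mod_cast hyp)
  obtain ⟨n, hn⟩ := Nat.exists_eq_add_of_le' hfl
  have hle : ((n + (r + 1) : ℕ) : ℝ) * p ≤ y := by
    rw [← le_div_iff₀ hp0, ← hn]
    exact Nat.floor_le (by linarith [(r.cast_nonneg : (0 : ℝ) ≤ r)])
  have hlow := trialsCDF_le hr n hp0.le (hle.trans hy)
  set Y : ℝ := ((n + (r + 1) : ℕ) : ℝ) * p with hY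
  have hY0 : 0 ≤ Y := by positivity
  have h1 : ∀ k : {n : ℕ // r ≤ n}, (Iic y).indicator (1 : ℝ → ℝ≥0∞) (((k.1 : ℝ) + 1) * p) ≤
      if k.1 ≤ r + n then 1 else 0 := by
    intro k
    split_ifs with hk
    · exact indicator_le_self' (fun _ _ => zero_le) _
    · refine (indicator_of_notMem ?_ _).le
      rw [mem_Iic, not_le, ← div_lt_iff₀ hp0]
      refine (Nat.lt_floor_add_one _).trans_le ?_
      rw [hn]
      exact_mod_cast (by omega : n + (r + 1) + 1 ≤ k.1 + 1)
  calc _ ≤ ∑' k : {n : ℕ // r ≤ n},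
        ENNReal.ofReal (trialsPMF r p k.1) * (if k.1 ≤ r + n then 1 else 0) :=
        ENNReal.tsum_le_tsum fun k => by gcongr; exact h1 k
    _ = ENNReal.ofReal (trialsCDF r p (r + n)) := tsum_trialsPMF_mul_indicator r _ hp'
    _ ≤ ENNReal.ofReal (1 - (gammaTail r Y + p / r * (Y * phi r Y))) :=
        ENNReal.ofReal_le_ofReal (by linarith)
    _ = 1 - gammaMixture r p (Ioi Y) := by
        rw [gammaMixture_Ioi hr1 hp' hY0, ENNReal.ofReal_sub, ENNReal.ofReal_one]
        have := gammaTail_nonneg r hY0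
        have := phi_nonneg r hY0
        positivity
    _ = gammaMixture r p (Iic Y) := by
        have hfin : gammaMixture r p (Ioi Y) ≠ ∞ := by
          rw [gammaMixture_Ioi hr1 hp' hY0]; exact ENNReal.ofReal_ne_top
        rw [← gammaMixture_univ hr1 hp', ← compl_Ioi,
          measure_compl measurableSet_Ioi hfin]
    _ ≤ _ := measure_mono (Iic_subset_Iic.2 hle)

theorem scaledTrials_Ici_le {r : ℕ} (hr : 3 ≤ r) {p : ℝ} (hp : p ∈ Ioo (0 : ℝ) 1) {x : ℝ}
    (hx : r + Real.sqrt r + 1 ≤ x) : scaledTrials r p (Ici x) ≤ gammaMixture r p (Ici x) := by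
  have hr1 : 1 ≤ r := by omega
  have hr3 : (3 : ℝ) ≤ r := by exact_mod_cast hr
  have hs2 : Real.sqrt r ^ 2 = r := Real.sq_sqrt (by linarith)
  have hs0 : 0 ≤ Real.sqrt r := Real.sqrt_nonneg _
  have hs1 : 3 / 2 ≤ Real.sqrt r := by nlinarith
  have hp' : p ∈ Icc (0 : ℝ) 1 := Ioo_subset_Icc_self hp
  have hp0 := hp.1
  have hxp : x ≤ x / p := by
    rw [le_div_iff₀ hp0]; nlinarith [hp.2]
  -- The first atom in [x, ∞) has N + 1 = ⌈x / p⌉ = n + r + 2, so the complementary event is N ≤ r +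
  -- n.
  have hcl : r + 2 ≤ ⌈x / p⌉₊ := by
    have : ((r + 2 : ℕ) : ℝ) ≤ ⌈x / p⌉₊ := by
      push_cast; linarith [Nat.le_ceil (x / p)]
    exact_mod_cast this
  obtain ⟨n, hn⟩ := Nat.exists_eq_add_of_le' hcl
  have hle : x ≤ ((n + (r + 2) : ℕ) : ℝ) * p := by
    rw [← div_le_iff₀ hp0, ← hn]
    exact Nat.le_ceil _
  have hupp := one_sub_trialsCDF_le hr n hp.2 (hx.trans hle)
  set X : ℝ := ((n + (r + 2) : ℕ) : ℝ) * p with hX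
  have hX0 : 0 ≤ X := by positivity
  have h1 : ENNReal.ofReal (trialsCDF r p (r + n)) ≤ scaledTrials r p (Iio x) := by
    rw [← tsum_trialsPMF_mul_indicator r _ hp', scaledTrials_apply r p measurableSet_Iio]
    refine ENNReal.tsum_le_tsum fun k => ?_
    gcongr
    split_ifs with hk
    · rw [indicator_of_mem, Pi.one_apply]
      rw [mem_Iio, ← lt_div_iff₀ hp0]
      have h2 : ((n + (r + 2) : ℕ) : ℝ) < x / p + 1 := by
        rw [← hn]; exact Nat.ceil_lt_add_one (by linarith)
      have h3 : ((k.1 + 2 : ℕ) : ℝ) ≤ ((n + (r + 2) : ℕ) : ℝ) := by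
        exact_mod_cast (by omega : k.1 + 2 ≤ n + (r + 2))
      push_cast at h2 h3
      linarith
    · exact zero_le
  have h2 : scaledTrials r p (Iio x) + scaledTrials r p (Ici x) ≤ 1 := by
    rw [← compl_Iio, measure_add_measure_compl measurableSet_Iio]
    exact scaledTrials_univ_le hr1 hp'
  have h3 : scaledTrials r p (Ici x) ≤ 1 - ENNReal.ofReal (trialsCDF r p (r + n)) := by
    refine ENNReal.le_sub_of_add_le_left ENNReal.ofReal_ne_top ?_
    exact (add_le_add_left h1 _).trans h2
  calc _ ≤ 1 - ENNReal.ofReal (trialsCDF r p (r + n)) := h3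
    _ = ENNReal.ofReal (1 - trialsCDF r p (r + n)) := by
        rw [ENNReal.ofReal_sub, ENNReal.ofReal_one]
        exact Finset.sum_nonneg fun n _ => trialsPMF_nonneg r n hp'
    _ ≤ ENNReal.ofReal (gammaTail r X + p / r * (X * phi r X)) :=
        ENNReal.ofReal_le_ofReal hupp
    _ = gammaMixture r p (Ioi X) := (gammaMixture_Ioi hr1 hp' hX0).symm
    _ ≤ _ := measure_mono fun z hz => hle.trans (le_of_lt hz)

/-! ### The asymptotic risk: measurability, finiteness, criticality -/

/-- Only values on (0, ∞) matter, so `L` can be replaced by a measurable function: the maximum of an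
antitone and a monotone function that agree with `L` on either side of `c` and are frozen at `L c`
beyond it. -/
theorem exists_measurable_eq_ofReal {L : ℝ → ℝ} {c : ℝ} (hc : 0 < c)
    (hanti : AntitoneOn L (Ioc 0 c)) (hmono : MonotoneOn L (Ici c)) :
    ∃ ℓ : ℝ → ℝ≥0∞, Measurable ℓ ∧ ∀ x, 0 < x → ℓ x = ENNReal.ofReal (L x) := by
  -- The value ⊤ for x ≤ 0 keeps this part antitone on the whole line.
  set ℓ₁ : ℝ → ℝ≥0∞ := fun x => if x ≤ 0 then ⊤ else ENNReal.ofReal (L (min x c)) with h1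
  set ℓ₂ : ℝ → ℝ≥0∞ := fun x => ENNReal.ofReal (L (max x c)) with h2
  have hm1 : Antitone ℓ₁ := by
    intro x y hxy
    simp only [h1]
    split_ifs with hy hx hx
    · exact le_rfl
    · exact absurd (hxy.trans hy) hx
    · exact le_top
    · exact ENNReal.ofReal_le_ofReal (hanti ⟨lt_min (not_le.1 hx) hc, min_le_right _ _⟩
        ⟨lt_min (not_le.1 hy) hc, min_le_right _ _⟩ (min_le_min_right c hxy))
  have hm2 : Monotone ℓ₂ := fun x y hxy => ENNReal.ofReal_le_ofReal
    (hmono (mem_Ici.2 (le_max_right _ _)) (mem_Ici.2 (le_max_right _ _)) (max_le_max_right c hxy))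
  refine ⟨fun x => max (ℓ₁ x) (ℓ₂ x), hm1.measurable.max hm2.measurable, fun x hx => ?_⟩
  simp only [h1, h2, if_neg (not_le.2 hx)]
  rcases le_total x c with hxc | hxc
  · rw [min_eq_left hxc, max_eq_right hxc]
    exact max_eq_left (ENNReal.ofReal_le_ofReal (hanti ⟨hx, hxc⟩ ⟨hc, le_rfl⟩ hxc))
  · rw [min_eq_right hxc, max_eq_left hxc]
    exact max_eq_right (ENNReal.ofReal_le_ofReal (hmono (mem_Ici.2 le_rfl) hxc hxc))

/-- The asymptotic risk for a loss with values in `[0, ∞]`. -/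
noncomputable def gammaRisk (r : ℕ) (ℓ : ℝ → ℝ≥0∞) (Ω : ℝ) : ℝ≥0∞ :=
  ∫⁻ x in Ioi (0 : ℝ), ENNReal.ofReal (phi r x) * ℓ (Ω / x)

theorem asymptoticRisk_eq_gammaRisk (r : ℕ) {L : ℝ → ℝ} {ℓ : ℝ → ℝ≥0∞}
    (hℓ : ∀ x, 0 < x → ℓ x = ENNReal.ofReal (L x)) {Ω : ℝ} (hΩ : 0 < Ω) :
    asymptoticRisk r L Ω = gammaRisk r ℓ Ω := by
  refine setLIntegral_congr_fun measurableSet_Ioi fun x hx => ?_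
  have hx0 : 0 < x := hx
  rw [hℓ _ (div_pos hΩ hx0), ENNReal.ofReal_mul (phi_nonneg r hx0.le)]

theorem setLIntegral_image_mul {t : ℝ} (ht : 0 < t) {s : Set ℝ} (hs : MeasurableSet s)
    (g : ℝ → ℝ≥0∞) :
    ∫⁻ x in (fun x => t * x) '' s, g x = ∫⁻ x in s, ENNReal.ofReal t * g (t * x) :=
  lintegral_image_eq_lintegral_deriv_mul_of_monotoneOn hs
    (fun x _ => by simpa using ((hasDerivAt_id x).const_mul t).hasDerivWithinAt)
    (fun _ _ _ _ h => by gcongr) g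

theorem image_mul_Ioi_zero {t : ℝ} (ht : 0 < t) :
    (fun x => t * x) '' Ioi (0 : ℝ) = Ioi 0 := by
  rw [image_mul_left_Ioi ht, mul_zero]

theorem integrableOn_phi_mul_rpow {r : ℕ} (hr : 1 ≤ r) {K : ℝ} (hK : K < r) {Ω : ℝ} (hΩ : 0 < Ω) :
    IntegrableOn (fun x => phi r x * (Ω / x) ^ K) (Ioi 0) := by
  have h := (Real.GammaIntegral_convergent (s := r - K) (by linarith)).const_mul
    (Ω ^ K / ((r - 1).factorial : ℝ))
  refine IntegrableOn.congr_fun (s := Ioi (0 : ℝ)) h (fun x hx => ?_) measurableSet_Ioi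
  have hx0 : 0 < x := hx
  have e : x ^ ((r : ℝ) - K - 1) = x ^ (r - 1) / x ^ K := by
    rw [← Real.rpow_natCast, ← Real.rpow_sub hx0]
    congr 1
    push_cast [hr]
    ring
  simp only [phi]
  rw [e, Real.div_rpow hΩ.le hx0.le]
  ring

theorem gammaRisk_ne_top {r : ℕ} (hr : 1 ≤ r) {L : ℝ → ℝ} (hL : IsLoss L)
    (h3 : HasPowerOrder r L) {c : ℝ} (hanti : AntitoneOn L (Ioc 0 c))
    (hmono : MonotoneOn L (Ici c)) {ℓ : ℝ → ℝ≥0∞}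
    (hℓ : ∀ x, 0 < x → ℓ x = ENNReal.ofReal (L x)) {Ω : ℝ} (hΩ : 0 < Ω) :
    gammaRisk r ℓ Ω ≠ ∞ := by
  obtain ⟨⟨K, hK, hΘ⟩, K', hK', hΘ'⟩ := h3
  obtain ⟨C, hC, hb⟩ := hΘ.1.exists_pos
  obtain ⟨C', hC', hb'⟩ := hΘ'.1.exists_pos
  obtain ⟨a, ha, hba⟩ := mem_nhdsGT_iff_exists_Ioo_subset.1 hb.bound
  obtain ⟨b, hbb⟩ := eventually_atTop.1 hb'.bound
  have ha0 : 0 < a := ha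
  set a' := a / 2 with ha'
  have ha'0 : 0 < a' := by positivity
  set b' := max b a with hb'd
  have hab : a' ≤ b' := by linarith [le_max_right b a]
  -- The power orders control `L` near 0 and near ∞; in between, a function that decreases and then
  -- increases is at most the sum of its nonnegative values at the two ends. Each of the three
  -- powers has exponent below r, hence is integrable against φ.
  have hbound : ∀ x, 0 < x → L x ≤ C * x ^ K + C' * x ^ K' + (L a' + L b') * x ^ (0 : ℝ) := by
    intro x hx
    have h0 : 0 ≤ C * x ^ K := by positivity
    have h0' : 0 ≤ C' * x ^ K' := by positivity
    have ha1 := hL a' ha'0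
    have hb1 := hL b' (ha'0.trans_le hab)
    rw [Real.rpow_zero, mul_one]
    rcases lt_or_ge x a with h | h
    · have := hba ⟨hx, h⟩
      simp only [mem_ofPred_eq, Real.norm_eq_abs, abs_of_nonneg (hL x hx),
        abs_of_pos (Real.rpow_pos_of_pos hx K)] at this
      linarith
    rcases le_or_gt b' x with h' | h'
    · have := hbb x ((le_max_left b a).trans h')
      simp only [Real.norm_eq_abs, abs_of_nonneg (hL x hx),
        abs_of_pos (Real.rpow_pos_of_pos hx K')] at this
      linarith
    have hax : a' ≤ x := by linarith
    rcases le_total x c with hc | hc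
    · have := hanti ⟨ha'0, hax.trans hc⟩ ⟨hx, hc⟩ hax
      linarith
    · have := hmono (mem_Ici.2 hc) (mem_Ici.2 (hc.trans h'.le)) h'.le
      linarith
  have hint := (((integrableOn_phi_mul_rpow hr hK hΩ).const_mul C).add
    ((integrableOn_phi_mul_rpow hr hK' hΩ).const_mul C')).add
    ((integrableOn_phi_mul_rpow hr (show (0 : ℝ) < r by exact_mod_cast hr) hΩ).const_mul
      (L a' + L b'))
  refine ne_top_of_le_ne_top hint.lintegral_lt_top.ne ?_
  refine setLIntegral_mono_ae' measurableSet_Ioi (Eventually.of_forall fun x hx => ?_)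
  have hx0 : 0 < x := hx
  have hφ := phi_nonneg r hx0.le
  rw [hℓ _ (div_pos hΩ hx0), ← ENNReal.ofReal_mul hφ]
  refine ENNReal.ofReal_le_ofReal ?_
  have := mul_le_mul_of_nonneg_left (hbound _ (div_pos hΩ hx0)) hφ
  simp only [Pi.add_apply]
  linarith

/-- A minimizer of the asymptotic risk is a critical point. -/
theorem lintegral_phi_mul_id_eq {r : ℕ} (hr : 1 ≤ r) {ℓ : ℝ → ℝ≥0∞} (hm : Measurable ℓ)
    (hfin : ∀ Ω, 0 < Ω → gammaRisk r ℓ Ω ≠ ∞) {Ω : ℝ} (hΩ : 0 < Ω)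
    (hmin : ∀ Ω', 0 < Ω' → gammaRisk r ℓ Ω ≤ gammaRisk r ℓ Ω') :
    ∫⁻ x in Ioi (0 : ℝ), ENNReal.ofReal (phi r x * x) * ℓ (Ω / x) = r * gammaRisk r ℓ Ω := by
  -- The factor exp(-x) of φ is left out of the density, so that the risk at Ω t becomes t ^ r times
  -- the Laplace transform of `μ` at t.
  set d : ℝ → ℝ≥0∞ := fun x => ENNReal.ofReal (x ^ (r - 1) / ((r - 1).factorial : ℝ)) * ℓ (Ω / x)
    with hd
  have hdm : Measurable d := by
    refine Measurable.mul (by fun_prop) (hm.comp ?_)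
    exact measurable_const.div measurable_id
  set μ : Measure ℝ := (volume.restrict (Ioi (0 : ℝ))).withDensity d with hμ
  have hlint : ∀ {g : ℝ → ℝ≥0∞}, Measurable g → ∫⁻ x, g x ∂μ = ∫⁻ x in Ioi (0 : ℝ), d x * g x :=
    fun hg => lintegral_withDensity_eq_lintegral_mul _ hdm hg
  have hexpm : ∀ t : ℝ, Measurable fun x : ℝ => Real.exp (-t * x) := fun t => by fun_prop
  have hE : ∀ t, 0 < t → gammaRisk r ℓ (Ω * t) =
      ENNReal.ofReal (t ^ r) * ∫⁻ x, ENNReal.ofReal (Real.exp (-t * x)) ∂μ := by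
    intro t ht
    have hdem : Measurable fun x => d x * ENNReal.ofReal (Real.exp (-t * x)) :=
      hdm.mul (hexpm t).ennreal_ofReal
    rw [hlint (hexpm t).ennreal_ofReal, ← lintegral_const_mul _ hdem, gammaRisk]
    conv_lhs => rw [← image_mul_Ioi_zero ht]
    rw [setLIntegral_image_mul ht measurableSet_Ioi]
    refine setLIntegral_congr_fun measurableSet_Ioi fun x hx => ?_
    have hx0 : 0 < x := hx
    have e1 : Ω * t / (t * x) = Ω / x := by field_simp
    have e2 : t ^ r = t * t ^ (r - 1) := by rw [← pow_succ', Nat.sub_add_cancel hr]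
    have e3 : t * phi r (t * x) =
        t ^ r * (x ^ (r - 1) / ((r - 1).factorial : ℝ) * Real.exp (-t * x)) := by
      rw [phi, e2, mul_pow, neg_mul]; ring
    simp only [hd]
    rw [e1, ← mul_assoc, ← ENNReal.ofReal_mul ht.le, e3, ENNReal.ofReal_mul (by positivity),
      ENNReal.ofReal_mul (by positivity)]
    ring
  have hAfin : ∀ t, 0 < t → ∫⁻ x, ENNReal.ofReal (Real.exp (-t * x)) ∂μ ≠ ∞ := by
    intro t ht htop
    have h1 := hfin (Ω * t) (by positivity)
    rw [hE t ht, htop, ENNReal.mul_top] at h1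
    · exact h1 rfl
    · exact (ENNReal.ofReal_pos.2 (by positivity)).ne'
  -- Finite risk at every Ω makes the transform finite on the open half-line, hence differentiable
  -- at -1.
  have hset : Iio (0 : ℝ) ⊆ ProbabilityTheory.integrableExpSet id μ := by
    intro t ht
    have h1 := hAfin (-t) (neg_pos.2 ht)
    rw [neg_neg] at h1
    refine ⟨by fun_prop, ?_⟩
    rw [hasFiniteIntegral_iff_ofReal (Eventually.of_forall fun x => (Real.exp_pos _).le)]
    exact lt_top_iff_ne_top.2 h1
  have hint : Iio (0 : ℝ) ⊆ interior (ProbabilityTheory.integrableExpSet id μ) :=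
    interior_maximal hset isOpen_Iio
  have hA : ∀ t, 0 < t → ∫⁻ x, ENNReal.ofReal (Real.exp (-t * x)) ∂μ =
      ENNReal.ofReal (ProbabilityTheory.mgf id μ (-t)) := by
    intro t ht
    rw [ProbabilityTheory.mgf, ofReal_integral_eq_lintegral_ofReal]
    · rfl
    · exact hset (neg_lt_zero.2 ht)
    · exact Eventually.of_forall fun x => (Real.exp_pos _).le
  set J : ℝ → ℝ := fun t => t ^ r * ProbabilityTheory.mgf id μ (-t) with hJ
  have hJE : ∀ t, 0 < t → gammaRisk r ℓ (Ω * t) = ENNReal.ofReal (J t) := by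
    intro t ht
    rw [hE t ht, hA t ht, ← ENNReal.ofReal_mul (by positivity)]
  have hmgf := ProbabilityTheory.hasDerivAt_mgf (X := id) (μ := μ) (t := -1)
    (hint (by simp))
  set B : ℝ := ∫ x, id x * Real.exp (-1 * id x) ∂μ with hB
  have hJd : HasDerivAt J (r * ProbabilityTheory.mgf id μ (-1) - B) 1 := by
    have h1 : HasDerivAt (fun t : ℝ => ProbabilityTheory.mgf id μ (-t)) (-B) 1 := by
      have := HasDerivAt.comp (1 : ℝ) (h₂ := ProbabilityTheory.mgf id μ) (h := fun t : ℝ => -t)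
        hmgf (hasDerivAt_neg (1 : ℝ))
      simpa [Function.comp_def] using this
    refine ((hasDerivAt_pow r (1 : ℝ)).mul h1).congr_deriv ?_
    simp
    ring
  have hJmin : IsLocalMin J 1 := by
    filter_upwards [lt_mem_nhds (zero_lt_one' ℝ)] with t ht
    have h1 := hmin (Ω * t) (by positivity)
    have h2 := hJE 1 one_pos
    rw [mul_one] at h2
    rw [h2, hJE t ht] at h1
    refine (ENNReal.ofReal_le_ofReal_iff ?_).1 h1
    have : 0 ≤ ProbabilityTheory.mgf id μ (-t) := ProbabilityTheory.mgf_nonneg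
    positivity
  have hcrit := hJmin.hasDerivAt_eq_zero hJd
  have hBint : Integrable (fun x => id x * Real.exp (-1 * id x)) μ := by
    simpa using ProbabilityTheory.integrable_pow_mul_exp_of_mem_interior_integrableExpSet
      (X := id) (μ := μ) (v := -1) (hint (by simp)) 1
  have hBnn : 0 ≤ᵐ[μ] fun x => id x * Real.exp (-1 * id x) := by
    have h1 : ∀ᵐ x ∂(volume.restrict (Ioi (0 : ℝ))), 0 ≤ id x * Real.exp (-1 * id x) := by
      filter_upwards [ae_restrict_mem measurableSet_Ioi] with x hx
      exact mul_nonneg (le_of_lt hx) (Real.exp_pos _).le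
    exact (withDensity_absolutelyContinuous _ _).ae_le h1
  have hBl := ofReal_integral_eq_lintegral_ofReal hBint hBnn
  have h2 := hJE 1 one_pos
  rw [mul_one] at h2
  have h3 : J 1 = ProbabilityTheory.mgf id μ (-1) := by simp [hJ]
  calc _ = ∫⁻ x, ENNReal.ofReal (id x * Real.exp (-1 * id x)) ∂μ := by
        rw [hlint (by fun_prop)]
        refine setLIntegral_congr_fun measurableSet_Ioi fun x hx => ?_
        have hx0 : 0 < x := hx
        have e3 : phi r x * x =
            x ^ (r - 1) / ((r - 1).factorial : ℝ) * (id x * Real.exp (-1 * id x)) := by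
          simp only [phi, id, neg_mul, one_mul]; ring
        simp only [hd]
        rw [e3, ENNReal.ofReal_mul (by positivity)]
        ring
    _ = ENNReal.ofReal B := hBl.symm
    _ = ENNReal.ofReal (r * ProbabilityTheory.mgf id μ (-1)) := by congr 1; linarith
    _ = _ := by
        rw [h2, h3, ENNReal.ofReal_mul (by positivity), ENNReal.ofReal_natCast]

theorem lintegral_gammaMixture_eq {r : ℕ} (hr : 1 ≤ r) {ℓ : ℝ → ℝ≥0∞} (hm : Measurable ℓ)
    (hfin : ∀ Ω, 0 < Ω → gammaRisk r ℓ Ω ≠ ∞) {Ω : ℝ} (hΩ : 0 < Ω)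
    (hmin : ∀ Ω', 0 < Ω' → gammaRisk r ℓ Ω ≤ gammaRisk r ℓ Ω') {p : ℝ}
    (hp : p ∈ Icc (0 : ℝ) 1) :
    ∫⁻ x, ℓ (Ω / x) ∂gammaMixture r p = gammaRisk r ℓ Ω := by
  have hr0 : (0 : ℝ) < r := by exact_mod_cast hr
  have hp0 := hp.1
  have hp1 : 0 ≤ 1 - p := by linarith [hp.2]
  have hℓm : Measurable fun x => ℓ (Ω / x) := hm.comp (measurable_const.div measurable_id)
  have hφm : Measurable (phi r) := (continuous_phi r).measurable
  rw [gammaMixture, lintegral_withDensity_eq_lintegral_mul _ (by fun_prop) hℓm]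
  calc _ = ∫⁻ x in Ioi (0 : ℝ), (ENNReal.ofReal (1 - p) * (ENNReal.ofReal (phi r x) * ℓ (Ω / x)) +
        ENNReal.ofReal (p / r) * (ENNReal.ofReal (phi r x * x) * ℓ (Ω / x))) := by
        refine setLIntegral_congr_fun measurableSet_Ioi fun x hx => ?_
        have hx0 : 0 < x := hx
        have hφ := phi_nonneg r hx0.le
        have e : phi r x * (1 - p + p * x / r) = (1 - p) * phi r x + p / r * (phi r x * x) := by
          ring
        simp only [Pi.mul_apply]
        rw [e, ENNReal.ofReal_add (by positivity) (by positivity), ENNReal.ofReal_mul hp1,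
          ENNReal.ofReal_mul (by positivity)]
        ring
    _ = ENNReal.ofReal (1 - p) * gammaRisk r ℓ Ω +
        ENNReal.ofReal (p / r) * (r * gammaRisk r ℓ Ω) := by
        rw [lintegral_add_left (by fun_prop), lintegral_const_mul _ (by fun_prop),
          lintegral_const_mul _ (by fun_prop), lintegral_phi_mul_id_eq hr hm hfin hΩ hmin, gammaRisk]
    _ = _ := by
        rw [← ENNReal.ofReal_natCast, ← mul_assoc, ← ENNReal.ofReal_mul (by positivity), ← add_mul,
          ← ENNReal.ofReal_add hp1 (by positivity)]
        have : 1 - p + p / r * r = 1 := by field_simp; ring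
        rw [this, ENNReal.ofReal_one, one_mul]

/-! ### The upper bound for the estimator Ω / (N + 1) -/

theorem risk_divSucc_eq (r : ℕ) {L : ℝ → ℝ} {ℓ : ℝ → ℝ≥0∞}
    (hℓ : ∀ x, 0 < x → ℓ x = ENNReal.ofReal (L x)) {Ω : ℝ} (hΩ : 0 < Ω) {p : ℝ} (hp : 0 < p) :
    risk r L (Estimator.divSucc r Ω hΩ) p = ∫⁻ z, ℓ (Ω / z) ∂scaledTrials r p := by
  rw [lintegral_scaledTrials, risk]
  refine tsum_congr fun n => ?_
  rw [Estimator.divSucc, Estimator.ofFun, diracProba, ProbabilityMeasure.coe_mk, lintegral_dirac,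
    hℓ _ (by positivity), div_div]

/-- The risk of `Ω / (N + 1)` does not exceed the asymptotic risk when `Ω` is optimal. -/
theorem supRisk_divSucc_le {r : ℕ} (hr : 3 ≤ r) {L : ℝ → ℝ} (hL : IsLoss L) {Ω : ℝ} (hΩ : 0 < Ω)
    {υ υ' : ℝ} (hυ : 0 < υ) (hυle : υ ≤ Ω / ((r : ℝ) + Real.sqrt r + 1))
    (hυ'ge : Ω / ((r : ℝ) - Real.sqrt r) ≤ υ') (hconst : IsConstantBetween L υ υ')
    {ℓ : ℝ → ℝ≥0∞} (hm : Measurable ℓ) (hℓ : ∀ x, 0 < x → ℓ x = ENNReal.ofReal (L x))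
    (hfin : ∀ Ω, 0 < Ω → gammaRisk r ℓ Ω ≠ ∞)
    (hmin : ∀ Ω', 0 < Ω' → gammaRisk r ℓ Ω ≤ gammaRisk r ℓ Ω') :
    supRisk r L (Estimator.divSucc r Ω hΩ) ≤ gammaRisk r ℓ Ω := by
  refine iSup₂_le fun p hp => ?_
  have hp0 := hp.1
  have hp' : p ∈ Icc (0 : ℝ) 1 := Ioo_subset_Icc_self hp
  have hr1 : 1 ≤ r := by omega
  rw [risk_divSucc_eq r hℓ hΩ hp0, ← lintegral_gammaMixture_eq hr1 hm hfin hΩ hmin hp']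
  have hr3 : (3 : ℝ) ≤ r := by exact_mod_cast hr
  have hs2 : Real.sqrt r ^ 2 = r := Real.sq_sqrt (by linarith)
  have hs0 : 0 ≤ Real.sqrt r := Real.sqrt_nonneg _
  have hs1 : 3 / 2 ≤ Real.sqrt r := by nlinarith
  have hy : 0 < (r : ℝ) - Real.sqrt r := by nlinarith
  have hx : 0 < (r : ℝ) + Real.sqrt r + 1 := by positivity
  obtain ⟨⟨C, hC⟩, hanti, hmono⟩ := hconst
  have hlt : Ω / ((r : ℝ) + Real.sqrt r + 1) ≤ Ω / ((r : ℝ) - Real.sqrt r) := by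
    gcongr
    linarith
  have hυυ' : υ ≤ υ' := hυle.trans (hlt.trans hυ'ge)
  -- The left tail comparison at 0 already gives this, since the mixture has no mass there.
  have hP0 : scaledTrials r p (Iic 0) = 0 := by
    rw [← nonpos_iff_eq_zero, ← gammaMixture_Iic_zero r p]
    exact scaledTrials_Iic_le hr hp hy.le
  set h : ℝ → ℝ := fun z => (ℓ (Ω / z)).toReal with hh
  have hhm : Measurable h := (hm.comp (measurable_const.div measurable_id)).ennreal_toReal
  have hhL : ∀ z, 0 < z → h z = L (Ω / z) := by
    intro z hz
    simp only [hh]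
    rw [hℓ _ (div_pos hΩ hz), ENNReal.toReal_ofReal (hL _ (div_pos hΩ hz))]
  have hae : ∀ μ : Measure ℝ, μ (Iic 0) = 0 →
      ∫⁻ z, ℓ (Ω / z) ∂μ = ∫⁻ z, ENNReal.ofReal (h z) ∂μ := by
    intro μ hμ
    have h1 : ∀ᵐ z ∂μ, 0 < z := by
      rw [ae_iff]
      simpa [not_lt, Iic_def] using hμ
    refine lintegral_congr_ae ?_
    filter_upwards [h1] with z hz
    rw [hhL z hz, hℓ _ (div_pos hΩ hz)]
  rw [hae _ hP0, hae _ (gammaMixture_Iic_zero r p)]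
  refine lintegral_le_of_tails_le (C := C) hP0 (gammaMixture_Iic_zero r p) ?_ hy (by linarith)
    (fun b hb => scaledTrials_Iic_le hr hp hb) (fun b hb => scaledTrials_Ici_le hr hp hb) hhm
    ?_ ?_ ?_ ?_
  · rw [gammaMixture_univ hr1 hp']
    exact scaledTrials_univ_le hr1 hp'
  · rw [← hC υ ⟨le_rfl, hυυ'⟩]
    exact hL υ hυ
  · intro z hz
    have hz0 : 0 < z := hy.trans_le hz.1
    rw [hhL z hz0]
    refine hC _ ⟨hυle.trans ?_, le_trans ?_ hυ'ge⟩
    · gcongr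
      exact hz.2
    · gcongr
      exact hz.1
  · intro a ha b hb hab
    rw [hhL a ha.1, hhL b hb.1]
    have ha0 := ha.1
    have hb2 : υ' ≥ 0 := hυ.le.trans hυυ'
    -- For z ≤ r - √r the argument Ω / z may still lie in the constant stretch, because Ω / (r - √r)
    -- can be smaller than `υ'`.
    rcases le_total υ' (Ω / b) with h1 | h1
    · refine hmono h1 (mem_Ici.2 (h1.trans ?_)) ?_ <;> gcongr
    · have hbC : L (Ω / b) = C := by
        refine hC _ ⟨hυle.trans (hlt.trans ?_), h1⟩
        have := hb.1
        gcongr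
        exact hb.2
      rw [hbC, ← hC υ' ⟨hυυ', le_rfl⟩]
      rcases le_total υ' (Ω / a) with h2 | h2
      · exact hmono (mem_Ici.2 le_rfl) h2 h2
      · rw [hC υ' ⟨hυυ', le_rfl⟩]
        refine (hC _ ⟨hυle.trans (hlt.trans ?_), h2⟩).ge
        gcongr
        exact ha.2
  · intro a ha b hb hab
    have ha0 : 0 < a := hx.trans_le ha
    have hb0 : 0 < b := hx.trans_le hb
    rw [hhL a ha0, hhL b hb0]
    have hba : Ω / b ≤ Ω / a := by gcongr
    have hup : ∀ c, (r : ℝ) + Real.sqrt r + 1 ≤ c → Ω / c ≤ υ' := fun c hc => by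
      refine le_trans ?_ (hlt.trans hυ'ge)
      gcongr
    rcases le_total (Ω / a) υ with h1 | h1
    · exact hanti ⟨div_pos hΩ hb0, hba.trans h1⟩ ⟨div_pos hΩ ha0, h1⟩ hba
    · rw [hC _ ⟨h1, hup a ha⟩]
      rcases le_total (Ω / b) υ with h2 | h2
      · rw [← hC υ ⟨le_rfl, hυυ'⟩]
        exact hanti ⟨div_pos hΩ hb0, h2⟩ ⟨hυ, le_rfl⟩ h2
      · exact (hC _ ⟨h2, hup b hb⟩).ge

/-! ### Truncation of the asymptotic risk, uniformly in Ω -/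

theorem exists_tail_le {f : ℝ → ℝ≥0∞} (hf : ∫⁻ x in Ioi (0 : ℝ), f x ≠ ∞) {e : ℝ≥0∞} (he : 0 < e) :
    ∃ T : ℝ, 0 < T ∧ ∫⁻ x in Ioi (0 : ℝ) \ Ioo T⁻¹ T, f x ≤ e := by
  set s : ℕ → Set ℝ := fun n => Ioi (0 : ℝ) \ Ioo ((n : ℝ) + 1)⁻¹ (n + 1) with hs
  set μ : Measure ℝ := (volume.restrict (Ioi (0 : ℝ))).withDensity f with hμ
  have hsm : ∀ n, MeasurableSet (s n) := fun n => measurableSet_Ioi.diff measurableSet_Ioo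
  have hanti : Antitone s := by
    intro m n hmn
    have h : (m : ℝ) + 1 ≤ n + 1 := by exact_mod_cast Nat.succ_le_succ hmn
    exact sdiff_subset_sdiff_right (Ioo_subset_Ioo (by gcongr) h)
  have hempty : ⋂ n, s n = ∅ := by
    refine eq_empty_of_forall_notMem fun x hx => ?_
    rw [mem_iInter] at hx
    have hx0 : 0 < x := (hx 0).1
    obtain ⟨n, hn⟩ := exists_nat_gt (max x x⁻¹)
    have h1 : x < n := (le_max_left _ _).trans_lt hn
    have h2 : x⁻¹ < n := (le_max_right _ _).trans_lt hn
    refine (hx n).2 ⟨?_, by linarith⟩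
    rw [inv_lt_comm₀ (by positivity) hx0]
    linarith
  have hμs : ∀ n, μ (s n) = ∫⁻ x in s n, f x := by
    intro n
    rw [hμ, withDensity_apply _ (hsm n), Measure.restrict_restrict (hsm n),
      inter_eq_left.2 sdiff_subset]
  have hlim : Tendsto (fun n => μ (s n)) atTop (𝓝 0) := by
    have := tendsto_measure_iInter_atTop (μ := μ) (fun n => (hsm n).nullMeasurableSet) hanti
      ⟨0, by
        rw [hμs]
        exact ne_top_of_le_ne_top hf (lintegral_mono_set sdiff_subset)⟩
    rwa [hempty, measure_empty] at this
  obtain ⟨n, hn⟩ := (hlim.eventually (ge_mem_nhds he)).exists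
  exact ⟨n + 1, by positivity, by rw [← hμs]; exact hn⟩

theorem Ioo_inv_subset {S T : ℝ} (hS : 0 < S) (hST : S ≤ T) : Ioo S⁻¹ S ⊆ Ioo T⁻¹ T :=
  Ioo_subset_Ioo (by gcongr) hST

/-- The asymptotic risk is attained, up to an arbitrarily small error, on a compact subset of
`(0, ∞)` that does not depend on `Ω`. -/
theorem exists_truncation {r : ℕ} {ℓ : ℝ → ℝ≥0∞} {c : ℝ} (hc : 0 < c)
    (hanti : AntitoneOn ℓ (Ioc 0 c)) (hmono : MonotoneOn ℓ (Ici c)) (hm : Measurable ℓ)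
    (hfin : ∀ Ω, 0 < Ω → gammaRisk r ℓ Ω ≠ ∞) {A B : ℝ≥0∞} (hAB : A < B)
    (hB : ∀ Ω, 0 < Ω → B ≤ gammaRisk r ℓ Ω) :
    ∃ T : ℝ, 0 < T ∧ ∀ Ω, 0 < Ω →
      A ≤ ∫⁻ x in Ioo T⁻¹ T, ENNReal.ofReal (phi r x) * ℓ (Ω / x) := by
  set F : ℝ → ℝ → ℝ≥0∞ := fun Ω x => ENNReal.ofReal (phi r x) * ℓ (Ω / x) with hF
  have hFm : ∀ Ω, Measurable (F Ω) := fun Ω =>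
    (continuous_phi r).measurable.ennreal_ofReal.mul (hm.comp (measurable_const.div measurable_id))
  have hsplit : ∀ Ω T, 0 < T → gammaRisk r ℓ Ω ≤
      (∫⁻ x in Ioo T⁻¹ T, F Ω x) + ∫⁻ x in Ioi (0 : ℝ) \ Ioo T⁻¹ T, F Ω x := by
    intro Ω T hT
    refine le_trans (lintegral_mono_set ?_) (lintegral_union_le _ _ _)
    intro x hx
    by_cases h : x ∈ Ioo T⁻¹ T
    · exact Or.inl h
    · exact Or.inr ⟨hx, h⟩
  set e : ℝ≥0∞ := (B - A) / 2 with he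
  have he0 : 0 < e := ENNReal.half_pos (tsub_pos_of_lt hAB).ne'
  have hBfin : B ≠ ∞ := ne_top_of_le_ne_top (hfin 1 one_pos) (hB 1 one_pos)
  have hefin : e ≠ ∞ := by
    refine ne_top_of_le_ne_top hBfin (ENNReal.half_le_self.trans tsub_le_self)
  have hBe : B = A + (e + e) := by
    rw [he, ENNReal.add_halves, add_tsub_cancel_of_le hAB.le]
  have hcancel : ∀ X : ℝ≥0∞, B ≤ X + (e + e) → A ≤ X := by
    intro X hX
    rw [hBe] at hX
    exact (ENNReal.add_le_add_iff_right (ENNReal.add_ne_top.2 ⟨hefin, hefin⟩)).1 hX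
  obtain ⟨T₁, hT₁, h₁⟩ := exists_tail_le (hfin 1 one_pos) he0
  -- These bounds confine Ω to a compact range: for x in (1 / T₁, T₁) one has α / x ≤ c ≤ β / x, so
  -- passing below α or above β can only raise the loss at such x.
  set α := min 1 (c / T₁) with hα
  set β := max 1 (c * T₁) with hβ
  have hα0 : 0 < α := lt_min one_pos (by positivity)
  have hβ0 : 0 < β := lt_of_lt_of_le one_pos (le_max_left _ _)
  obtain ⟨T₂, hT₂, h₂⟩ := exists_tail_le (hfin α hα0) he0
  obtain ⟨T₃, hT₃, h₃⟩ := exists_tail_le (hfin β hβ0) he0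
  -- An extreme Ω is compared with a = α or a = β. Where the loss at a / x exceeds that at Ω / x, it
  -- is at most the loss at 1 / x, and this happens only outside (1 / T₁, T₁), at a cost of at most
  -- `e`; the truncation at a costs another `e`.
  have hextreme : ∀ a T Ω, 0 < T → B ≤ gammaRisk r ℓ a →
      ∫⁻ x in Ioi (0 : ℝ) \ Ioo T⁻¹ T, F a x ≤ e →
      (∀ x, 0 < x → x ∈ Ioo T₁⁻¹ T₁ → ℓ (a / x) ≤ ℓ (Ω / x)) →
      (∀ x, 0 < x → ℓ (a / x) ≤ ℓ (Ω / x) ∨ ℓ (a / x) ≤ ℓ (1 / x)) →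
      A ≤ ∫⁻ x in Ioo T⁻¹ T, F Ω x := by
    intro a T Ω hT hBa htail hin hor
    refine hcancel _ (hBa.trans ((hsplit a T hT).trans ?_))
    rw [← add_assoc]
    refine add_le_add ?_ htail
    have hpos : Ioo T⁻¹ T ⊆ Ioi (0 : ℝ) := fun x hx => (inv_pos.2 hT).trans hx.1
    calc ∫⁻ x in Ioo T⁻¹ T, F a x
        ≤ ∫⁻ x in Ioo T⁻¹ T, (F Ω x + (Ioi (0 : ℝ) \ Ioo T₁⁻¹ T₁).indicator (F 1) x) := by
          refine setLIntegral_mono' measurableSet_Ioo fun x hx => ?_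
          have hx0 : 0 < x := hpos hx
          by_cases hxT : x ∈ Ioo T₁⁻¹ T₁
          · refine le_add_right ?_
            simp only [hF]
            gcongr
            exact hin x hx0 hxT
          · rw [indicator_of_mem (show x ∈ Ioi (0 : ℝ) \ Ioo T₁⁻¹ T₁ from ⟨hx0, hxT⟩)]
            simp only [hF]
            rcases hor x hx0 with h | h
            · refine le_add_right ?_
              gcongr
            · refine le_add_left ?_
              gcongr
      _ = (∫⁻ x in Ioo T⁻¹ T, F Ω x) +
          ∫⁻ x in Ioo T⁻¹ T, (Ioi (0 : ℝ) \ Ioo T₁⁻¹ T₁).indicator (F 1) x :=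
          lintegral_add_left (hFm Ω) _
      _ ≤ (∫⁻ x in Ioo T⁻¹ T, F Ω x) + e := by
          gcongr
          refine le_trans ?_ h₁
          rw [← lintegral_indicator (measurableSet_Ioi.diff measurableSet_Ioo)]
          exact setLIntegral_le_lintegral _ _
  refine ⟨max T₂ T₃, lt_max_of_lt_left hT₂, fun Ω hΩ => ?_⟩
  rcases le_total Ω α with hΩα | hΩα
  · refine (hextreme α T₂ Ω hT₂ (hB α hα0) h₂ ?_ ?_).trans
      (lintegral_mono_set (Ioo_inv_subset hT₂ (le_max_left _ _)))
    · intro x hx hxT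
      have h1 : α / x ≤ c := by
        rw [div_le_iff₀ hx]
        calc α ≤ c / T₁ := min_le_right _ _
          _ = c * T₁⁻¹ := div_eq_mul_inv _ _
          _ ≤ c * x := by gcongr; exact hxT.1.le
      have h2 : Ω / x ≤ α / x := by gcongr
      exact hanti ⟨by positivity, h2.trans h1⟩ ⟨by positivity, h1⟩ h2
    · intro x hx
      have h2 : Ω / x ≤ α / x := by gcongr
      rcases le_total (α / x) c with h1 | h1
      · exact Or.inl (hanti ⟨by positivity, h2.trans h1⟩ ⟨by positivity, h1⟩ h2)
      · have h3 : α / x ≤ 1 / x := by gcongr; exact min_le_left _ _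
        exact Or.inr (hmono (mem_Ici.2 h1) (mem_Ici.2 (h1.trans h3)) h3)
  rcases le_total β Ω with hΩβ | hΩβ
  · refine (hextreme β T₃ Ω hT₃ (hB β hβ0) h₃ ?_ ?_).trans
      (lintegral_mono_set (Ioo_inv_subset hT₃ (le_max_right _ _)))
    · intro x hx hxT
      have h1 : c ≤ β / x := by
        rw [le_div_iff₀ hx]
        calc c * x ≤ c * T₁ := by gcongr; exact hxT.2.le
          _ ≤ β := le_max_right _ _
      have h2 : β / x ≤ Ω / x := by gcongr
      exact hmono (mem_Ici.2 h1) (mem_Ici.2 (h1.trans h2)) h2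
    · intro x hx
      have h2 : β / x ≤ Ω / x := by gcongr
      rcases le_total c (β / x) with h1 | h1
      · exact Or.inl (hmono (mem_Ici.2 h1) (mem_Ici.2 (h1.trans h2)) h2)
      · have h3 : 1 / x ≤ β / x := by gcongr; exact le_max_left _ _
        exact Or.inr (hanti ⟨by positivity, h3.trans h1⟩ ⟨by positivity, h1⟩ h3)
  · have hT : 0 < max T₂ T₃ := lt_max_of_lt_left hT₂
    refine hcancel _ ((hB Ω hΩ).trans ((hsplit Ω _ hT).trans (add_le_add le_rfl ?_)))
    -- For α ≤ Ω ≤ β, unimodality bounds the loss at Ω / x by the sum of those at α / x and β / x,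
    -- so the tail is uniformly small.
    calc ∫⁻ x in Ioi (0 : ℝ) \ Ioo (max T₂ T₃)⁻¹ (max T₂ T₃), F Ω x
        ≤ ∫⁻ x in Ioi (0 : ℝ) \ Ioo (max T₂ T₃)⁻¹ (max T₂ T₃), (F α x + F β x) := by
          refine setLIntegral_mono' (measurableSet_Ioi.diff measurableSet_Ioo) fun x hx => ?_
          have hx0 : 0 < x := hx.1
          simp only [hF]
          rw [← mul_add]
          gcongr
          have h1 : α / x ≤ Ω / x := by gcongr
          have h2 : Ω / x ≤ β / x := by gcongr
          rcases le_total (Ω / x) c with h | h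
          · exact le_add_right (hanti ⟨by positivity, h1.trans h⟩ ⟨by positivity, h⟩ h1)
          · exact le_add_left (hmono (mem_Ici.2 h) (mem_Ici.2 (h.trans h2)) h2)
      _ = (∫⁻ x in Ioi (0 : ℝ) \ Ioo (max T₂ T₃)⁻¹ (max T₂ T₃), F α x) +
          ∫⁻ x in Ioi (0 : ℝ) \ Ioo (max T₂ T₃)⁻¹ (max T₂ T₃), F β x :=
          lintegral_add_left (hFm α) _
      _ ≤ e + e := by
          refine add_le_add (le_trans (lintegral_mono_set ?_) h₂)
            (le_trans (lintegral_mono_set ?_) h₃)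
          · exact sdiff_subset_sdiff_right (Ioo_inv_subset hT₂ (le_max_left _ _))
          · exact sdiff_subset_sdiff_right (Ioo_inv_subset hT₃ (le_max_right _ _))

/-! ### The lower bound: averaging the risk over dp / p -/

/-- With y = x / n, take the n-th power of exp(-y)(1 - y²) ≤ 1 - y and apply Bernoulli's inequality
to (1 - y²) ^ n. -/
theorem exp_neg_mul_one_sub_le_pow {n : ℕ} (hn : 1 ≤ n) {x : ℝ} (hx0 : 0 ≤ x) (hxn : x ≤ n) :
    Real.exp (-x) * (1 - x ^ 2 / n) ≤ (1 - x / n) ^ n := by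
  have hn0 : (0 : ℝ) < n := by exact_mod_cast hn
  set y := x / n with hy
  have hy0 : 0 ≤ y := by positivity
  have hy1 : y ≤ 1 := by rw [hy, div_le_one hn0]; exact hxn
  have h1 : Real.exp (-y) * (1 - y ^ 2) ≤ 1 - y := by
    have h2 : Real.exp (-y) * (1 + y) ≤ 1 := by
      rw [Real.exp_neg, inv_mul_le_one₀ (Real.exp_pos y)]
      linarith [Real.add_one_le_exp y]
    nlinarith
  have h2 : 1 + n * (-y ^ 2) ≤ (1 + -y ^ 2) ^ n :=
    one_add_mul_le_pow (by nlinarith) n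
  have h3 : 0 ≤ 1 - y ^ 2 := by nlinarith
  calc Real.exp (-x) * (1 - x ^ 2 / n) = Real.exp (-y) ^ n * (1 + n * (-y ^ 2)) := by
        rw [← Real.exp_nat_mul]
        have e1 : (n : ℝ) * -y = -x := by rw [hy]; field_simp
        rw [e1, hy]
        field_simp
        ring
    _ ≤ Real.exp (-y) ^ n * (1 + -y ^ 2) ^ n := by gcongr
    _ = (Real.exp (-y) * (1 - y ^ 2)) ^ n := by rw [mul_pow, sub_eq_add_neg]
    _ ≤ _ := by gcongr

/-- At p = x / n, passing from the gamma density to the probability function costs at most the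
factors 1 - r²/n (falling factorial) and 1 - T²/n (exponential). Their product is at least n / (n +
D), so the error is only a shift of n, harmless in a harmonic sum. -/
theorem phi_div_le_trialsPMF {r : ℕ} (hr : 1 ≤ r) {T : ℝ} {D n : ℕ}
    (hD : 2 * ((r : ℝ) ^ 2 + T ^ 2) ≤ D) (hn : D ≤ n) {x : ℝ} (hx : 0 < x) (hxT : x ≤ T) :
    phi r x / (n + D) ≤ trialsPMF r (x / n) n / x := by
  have hr1 : (1 : ℝ) ≤ r := by exact_mod_cast hr
  have hDn : (D : ℝ) ≤ n := by exact_mod_cast hn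
  set C : ℝ := (r : ℝ) ^ 2 + T ^ 2 with hC
  have hrn' : (r : ℝ) ≤ n := by nlinarith [sq_nonneg T]
  have hrn : r ≤ n := by exact_mod_cast hrn'
  have hn1 : 1 ≤ n := hr.trans hrn
  have hn0 : (0 : ℝ) < n := by exact_mod_cast hn1
  have hxn : x ≤ n := by nlinarith
  have hC0 : 0 ≤ C := by positivity
  have h1 : Real.exp (-x) * (1 - T ^ 2 / n) ≤ (1 - x / n) ^ (n - r) := by
    have hx1 : x / n ≤ 1 := by rw [div_le_one hn0]; exact hxn
    calc _ ≤ Real.exp (-x) * (1 - x ^ 2 / n) := by gcongr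
      _ ≤ (1 - x / n) ^ n := exp_neg_mul_one_sub_le_pow hn1 hx.le hxn
      _ ≤ _ := pow_le_pow_of_le_one (by linarith) (by linarith [div_pos hx hn0]) (Nat.sub_le n r)
  have h2 : (n : ℝ) ^ (r - 1) * (1 - r ^ 2 / n) ≤ ((n - 1).descFactorial (r - 1) : ℝ) := by
    have h3 : ((n - 1 + 1 - (r - 1)) ^ (r - 1) : ℕ) ≤ (n - 1).descFactorial (r - 1) :=
      Nat.pow_sub_le_descFactorial _ _
    rw [Nat.sub_add_cancel hn1] at h3
    have h4 : (((n - (r - 1)) ^ (r - 1) : ℕ) : ℝ) ≤ ((n - 1).descFactorial (r - 1) : ℝ) := by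
      exact_mod_cast h3
    refine le_trans ?_ h4
    have hk : r - 1 ≤ n := (Nat.sub_le r 1).trans hrn
    have hkr : ((r - 1 : ℕ) : ℝ) ≤ r := by exact_mod_cast Nat.sub_le r 1
    set k := r - 1 with hkdef
    push_cast [hk]
    have hk0 : (0 : ℝ) ≤ k := k.cast_nonneg
    have hkn : (k : ℝ) / n ≤ 1 := by
      rw [div_le_one hn0]; exact hkr.trans hrn'
    have h5 : 1 + (k : ℝ) * (-(k / n)) ≤ (1 + -((k : ℝ) / n)) ^ k :=
      one_add_mul_le_pow (by linarith) k
    have h6 : (n : ℝ) - k = n * (1 + -((k : ℝ) / n)) := by field_simp; ring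
    rw [h6, mul_pow]
    have h7 : (k : ℝ) ^ 2 / n ≤ r ^ 2 / n := by gcongr
    have h8 : (k : ℝ) * (-(k / n)) = -(k ^ 2 / n) := by ring
    gcongr
    linarith
  have ha : 0 ≤ 1 - (r : ℝ) ^ 2 / n := by
    rw [sub_nonneg, div_le_one hn0]; nlinarith [sq_nonneg T]
  have hb : 0 ≤ 1 - T ^ 2 / n := by
    rw [sub_nonneg, div_le_one hn0]; nlinarith [sq_nonneg (r : ℝ)]
  have h3 : (n : ℝ) / (n + D) ≤ (1 - r ^ 2 / n) * (1 - T ^ 2 / n) := by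
    calc (n : ℝ) / (n + D) ≤ n / (n + 2 * C) := by gcongr
      _ ≤ 1 - C / n := by
          rw [div_le_iff₀ (by positivity), ← sub_nonneg]
          have : (1 - C / n) * (n + 2 * C) - n = C * (n - 2 * C) / n := by field_simp; ring
          rw [this]
          have : 0 ≤ n - 2 * C := by linarith
          positivity
      _ ≤ _ := by
          have : (1 - (r : ℝ) ^ 2 / n) * (1 - T ^ 2 / n) = 1 - C / n + r ^ 2 / n * (T ^ 2 / n) := by
            rw [hC]; ring
          rw [this]
          have : 0 ≤ (r : ℝ) ^ 2 / n * (T ^ 2 / n) := by positivity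
          linarith
  have e1 : trialsPMF r (x / n) n / x = x ^ (r - 1) / ((r - 1).factorial : ℝ) / (n * n ^ (r - 1)) *
      (((n - 1).descFactorial (r - 1) : ℝ) * (1 - x / n) ^ (n - r)) := by
    have h4 : x ^ r = x * x ^ (r - 1) := by rw [← pow_succ', Nat.sub_add_cancel hr]
    have h5 : (n : ℝ) ^ r = n * n ^ (r - 1) := by rw [← pow_succ', Nat.sub_add_cancel hr]
    rw [trialsPMF, div_pow, h4, h5]
    field_simp
  rw [e1]
  calc phi r x / (n + D) = x ^ (r - 1) / ((r - 1).factorial : ℝ) / (n * n ^ (r - 1)) *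
        (n ^ (r - 1) * Real.exp (-x) * (n / (n + D))) := by
        rw [phi]; field_simp
    _ ≤ x ^ (r - 1) / ((r - 1).factorial : ℝ) / (n * n ^ (r - 1)) *
        (n ^ (r - 1) * Real.exp (-x) * ((1 - r ^ 2 / n) * (1 - T ^ 2 / n))) := by gcongr
    _ = x ^ (r - 1) / ((r - 1).factorial : ℝ) / (n * n ^ (r - 1)) *
        ((n ^ (r - 1) * (1 - r ^ 2 / n)) * (Real.exp (-x) * (1 - T ^ 2 / n))) := by ring
    _ ≤ _ := by gcongr

theorem log_sub_log_le_sum {m : ℕ} (hm : 1 ≤ m) {k : ℕ} (hk : m ≤ k) (D : ℕ) :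
    Real.log (k + 1) - Real.log (m + D) ≤ ∑ n ∈ Finset.Icc m k, 1 / ((n : ℝ) + D) := by
  suffices h : Real.log (k + 1 + D) - Real.log (m + D) ≤
      ∑ n ∈ Finset.Icc m k, 1 / ((n : ℝ) + D) by
    refine le_trans (sub_le_sub_right (Real.log_le_log (by positivity) ?_) _) h
    linarith [(D.cast_nonneg : (0 : ℝ) ≤ D)]
  have hstep : ∀ a : ℝ, 0 < a → Real.log (a + 1) - Real.log a ≤ 1 / a := by
    intro a ha
    rw [← Real.log_div (by positivity) ha.ne']
    refine (Real.log_le_sub_one_of_pos (by positivity)).trans (le_of_eq ?_)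
    field_simp
    ring
  induction k, hk using Nat.le_induction with
  | base =>
    have : (0 : ℝ) < m + D := by
      have : (0 : ℝ) < m := by exact_mod_cast hm
      positivity
    have := hstep _ this
    simp only [Finset.Icc_self, Finset.sum_singleton]
    rwa [add_right_comm] at this
  | succ k hk ih =>
    rw [Finset.sum_Icc_succ_top (by omega)]
    have : (0 : ℝ) < ((k + 1 : ℕ) : ℝ) + D := by positivity
    have := hstep _ this
    push_cast at this ⊢
    have e : (k : ℝ) + 1 + 1 + D = k + 1 + D + 1 := by ring
    rw [e]
    linarith

theorem lintegral_Ioc_inv {a b : ℝ} (ha : 0 < a) (hab : a ≤ b) :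
    ∫⁻ p in Ioc a b, ENNReal.ofReal p⁻¹ = ENNReal.ofReal (Real.log (b / a)) := by
  have hb : 0 < b := ha.trans_le hab
  rw [← integral_inv_of_pos ha hb, intervalIntegral.integral_of_le hab,
    ofReal_integral_eq_lintegral_ofReal]
  · refine (intervalIntegrable_iff_integrableOn_Ioc_of_le hab).1 ?_
    refine intervalIntegral.intervalIntegrable_inv (fun x hx => ?_) continuousOn_id
    rw [uIcc_of_le hab] at hx
    exact (ha.trans_le hx.1).ne'
  · filter_upwards [ae_restrict_mem measurableSet_Ioc] with x hx
    exact inv_nonneg.2 (ha.trans hx.1).le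

theorem mul_le_lintegral_trialsPMF {r : ℕ} (hr : 1 ≤ r) {ℓ : ℝ → ℝ≥0∞} {T : ℝ} {A : ℝ≥0∞}
    (hA : ∀ Ω, 0 < Ω → A ≤ ∫⁻ x in Ioo T⁻¹ T, ENNReal.ofReal (phi r x) * ℓ (Ω / x)) (hT : 0 < T)
    {D n : ℕ} (hD : 2 * ((r : ℝ) ^ 2 + T ^ 2) ≤ D) (hn : D ≤ n) {a b : ℝ} (hn0 : 0 < n)
    (ha : a ≤ (n : ℝ)⁻¹ * T⁻¹) (hb : (n : ℝ)⁻¹ * T ≤ b) (hb1 : b ≤ 1) {y : ℝ} (hy : 0 < y) :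
    ENNReal.ofReal (1 / ((n : ℝ) + D)) * A ≤ ∫⁻ p in Ioc a b,
      ENNReal.ofReal p⁻¹ * (ENNReal.ofReal (trialsPMF r p n) * ℓ (y / p)) := by
  have hn0' : (0 : ℝ) < n := by exact_mod_cast hn0
  have hsub : (fun x => (n : ℝ)⁻¹ * x) '' Ioo T⁻¹ T ⊆ Ioc a b := by
    rintro _ ⟨x, hx, rfl⟩
    refine ⟨ha.trans_lt ?_, le_trans ?_ hb⟩
    · exact mul_lt_mul_of_pos_left hx.1 (inv_pos.2 hn0')
    · exact mul_le_mul_of_nonneg_left hx.2.le (inv_pos.2 hn0').le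
  refine le_trans ?_ (lintegral_mono_set hsub)
  rw [setLIntegral_image_mul (inv_pos.2 hn0') measurableSet_Ioo]
  -- With p = x / n the ratio y / p is y n / x, so the reported value y merely selects Ω = y n; the
  -- bound holds for every y.
  refine (mul_le_mul_right (hA (y * n) (by positivity)) _).trans ?_
  rw [← lintegral_const_mul' _ _ ENNReal.ofReal_ne_top]
  refine setLIntegral_mono' measurableSet_Ioo fun x hx => ?_
  have hx0 : 0 < x := (inv_pos.2 hT).trans hx.1
  have e1 : y / ((n : ℝ)⁻¹ * x) = y * n / x := by field_simp
  have e2 : (n : ℝ)⁻¹ * x = x / n := by rw [div_eq_inv_mul]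
  have hx1 : x / n ∈ Icc (0 : ℝ) 1 := by
    refine ⟨by positivity, ?_⟩
    rw [← e2]
    refine le_trans ?_ (hb.trans hb1)
    have := hx.2.le
    gcongr
  rw [e1, ← mul_assoc, ← mul_assoc, ← mul_assoc, e2]
  refine mul_le_mul' ?_ le_rfl
  have hφ := phi_nonneg r hx0.le
  have hf := trialsPMF_nonneg r n hx1
  rw [← ENNReal.ofReal_mul (by positivity), ← ENNReal.ofReal_mul (by positivity),
    ← ENNReal.ofReal_mul (by positivity)]
  refine ENNReal.ofReal_le_ofReal ?_
  calc 1 / ((n : ℝ) + D) * phi r x = phi r x / (n + D) := by ring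
    _ ≤ trialsPMF r (x / n) n / x := phi_div_le_trialsPMF hr hD hn hx0 hx.2.le
    _ = _ := by field_simp

theorem sum_mul_le_supRisk_mul_log {r : ℕ} (hr : 1 ≤ r) {L : ℝ → ℝ} {ℓ : ℝ → ℝ≥0∞}
    (hm : Measurable ℓ) (hℓ : ∀ x, 0 < x → ℓ x = ENNReal.ofReal (L x)) {T : ℝ} (hT : 0 < T)
    {A : ℝ≥0∞}
    (hA : ∀ Ω, 0 < Ω → A ≤ ∫⁻ x in Ioo T⁻¹ T, ENNReal.ofReal (phi r x) * ℓ (Ω / x))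
    (G : Estimator r) {D m k : ℕ} (hD : 2 * ((r : ℝ) ^ 2 + T ^ 2) ≤ D) (hDm : D ≤ m)
    (hrm : r ≤ m) (hTm : 2 * T ≤ m) (hTm' : 2 / T ≤ m) (hmk : m ≤ k) :
    ENNReal.ofReal (∑ n ∈ Finset.Icc m k, 1 / ((n : ℝ) + D)) * A ≤
      supRisk r L G * ENNReal.ofReal (Real.log (T * k / 2)) := by
  have hmpos : 0 < m := by omega
  have hm0 : (0 : ℝ) < m := by exact_mod_cast hmpos
  have hkm : (m : ℝ) ≤ k := by exact_mod_cast hmk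
  have hk0 : (0 : ℝ) < k := hm0.trans_le hkm
  -- With this left end, (a, 1/2] contains the image of (1 / T, T) under x ↦ x / n for every n from
  -- m to k; the right end uses 2T ≤ m. The prior then has mass log(T k / 2).
  set a : ℝ := (k : ℝ)⁻¹ * T⁻¹ with ha
  have ha0 : 0 < a := by positivity
  have hab : a ≤ 1 / 2 := by
    rw [ha, ← mul_inv, ← one_div]
    refine one_div_le_one_div_of_le two_pos ?_
    rw [div_le_iff₀ hT] at hTm'
    nlinarith
  have hprior : ∫⁻ p in Ioc a (1 / 2), ENNReal.ofReal p⁻¹ * risk r L G p ≤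
      supRisk r L G * ENNReal.ofReal (Real.log (T * k / 2)) := by
    have e : T * k / 2 = 1 / 2 / a := by rw [ha]; field_simp
    rw [e, ← lintegral_Ioc_inv ha0 hab, mul_comm, ← lintegral_mul_const _ (by fun_prop)]
    refine setLIntegral_mono' measurableSet_Ioc fun p hp => ?_
    gcongr
    exact le_iSup₂ (f := fun p (_ : p ∈ Ioo (0 : ℝ) 1) => risk r L G p) p
      ⟨ha0.trans hp.1, by linarith [hp.2]⟩
  refine le_trans ?_ hprior
  have hPm : ∀ n : ℕ, Measurable fun p : ℝ => trialsPMF r p n := by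
    intro n
    unfold trialsPMF
    fun_prop
  have hjoint : ∀ n : ℕ, Measurable fun q : ℝ × Ioi (0 : ℝ) => ENNReal.ofReal q.1⁻¹ *
      (ENNReal.ofReal (trialsPMF r q.1 n) * ℓ ((q.2 : ℝ) / q.1)) := by
    intro n
    have h1 : Measurable fun q : ℝ × Ioi (0 : ℝ) => (q.2 : ℝ) / q.1 :=
      (measurable_subtype_coe.comp measurable_snd).div measurable_fst
    have h2 : Measurable fun q : ℝ × Ioi (0 : ℝ) => trialsPMF r q.1 n :=
      (hPm n).comp measurable_fst
    exact measurable_fst.inv.ennreal_ofReal.mul (h2.ennreal_ofReal.mul (hm.comp h1))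
  have hrisk : ∫⁻ p in Ioc a (1 / 2), ENNReal.ofReal p⁻¹ * risk r L G p =
      ∑' n : {n : ℕ // r ≤ n}, ∫⁻ y, ∫⁻ p in Ioc a (1 / 2), ENNReal.ofReal p⁻¹ *
        (ENNReal.ofReal (trialsPMF r p n.1) * ℓ ((y : ℝ) / p))
          ∂volume ∂(G n : Measure (Ioi (0 : ℝ))) := by
    calc _ = ∫⁻ p in Ioc a (1 / 2), ∑' n : {n : ℕ // r ≤ n}, ∫⁻ y, ENNReal.ofReal p⁻¹ *
        (ENNReal.ofReal (trialsPMF r p n.1) * ℓ ((y : ℝ) / p))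
          ∂(G n : Measure (Ioi (0 : ℝ))) := by
          refine setLIntegral_congr_fun measurableSet_Ioc fun p hp => ?_
          have hp0 : 0 < p := ha0.trans hp.1
          simp only [risk]
          rw [← ENNReal.tsum_mul_left]
          refine tsum_congr fun n => ?_
          rw [lintegral_const_mul' _ _ ENNReal.ofReal_ne_top,
            lintegral_const_mul' _ _ ENNReal.ofReal_ne_top]
          congr 2
          refine lintegral_congr fun y => ?_
          exact (hℓ _ (div_pos y.2 hp0)).symm
      _ = ∑' n : {n : ℕ // r ≤ n}, ∫⁻ p in Ioc a (1 / 2), ∫⁻ y, ENNReal.ofReal p⁻¹ *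
        (ENNReal.ofReal (trialsPMF r p n.1) * ℓ ((y : ℝ) / p))
          ∂(G n : Measure (Ioi (0 : ℝ))) :=
          lintegral_tsum fun n => (hjoint n.1).lintegral_prod_right'.aemeasurable
      _ = _ := tsum_congr fun n => lintegral_lintegral_swap (hjoint n.1).aemeasurable
  rw [hrisk]
  set g : ℕ → ℝ≥0∞ := fun n =>
    if n ∈ Finset.Icc m k then ENNReal.ofReal (1 / ((n : ℝ) + D)) * A else 0 with hg
  calc _ = ∑ n ∈ Finset.Icc m k, {n : ℕ | r ≤ n}.indicator g n := by
        rw [ENNReal.ofReal_sum_of_nonneg fun n _ => by positivity, Finset.sum_mul]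
        refine Finset.sum_congr rfl fun n hn => ?_
        have hrn : r ≤ n := hrm.trans (Finset.mem_Icc.1 hn).1
        rw [indicator_of_mem (show n ∈ {n : ℕ | r ≤ n} from hrn)]
        simp only [hg, if_pos hn]
    _ ≤ ∑' n, {n : ℕ | r ≤ n}.indicator g n := ENNReal.sum_le_tsum _
    _ = ∑' n : {n : ℕ // r ≤ n}, g n.1 := (tsum_subtype {n : ℕ | r ≤ n} g).symm
    _ ≤ _ := by
        refine ENNReal.tsum_le_tsum fun n => ?_
        simp only [hg]
        split_ifs with hn
        · obtain ⟨hmn, hnk⟩ := Finset.mem_Icc.1 hn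
          have hmn' : (m : ℝ) ≤ n.1 := by exact_mod_cast hmn
          have hnk' : (n.1 : ℝ) ≤ k := by exact_mod_cast hnk
          have hn0' : (0 : ℝ) < n.1 := hm0.trans_le hmn'
          -- Each conditional law is a probability measure, so a bound uniform in y passes through
          -- randomization unchanged.
          calc _ = ∫⁻ _, ENNReal.ofReal (1 / ((n.1 : ℝ) + D)) * A
                ∂(G n : Measure (Ioi (0 : ℝ))) := by simp
            _ ≤ _ := by
                refine lintegral_mono fun y => ?_
                refine mul_le_lintegral_trialsPMF hr hA hT hD (hDm.trans hmn)
                  (hmpos.trans_le hmn) ?_ ?_ (by norm_num) y.2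
                · rw [ha]; gcongr
                · rw [inv_mul_le_iff₀ hn0']; linarith
        · exact zero_le

theorem le_supRisk {r : ℕ} (hr : 1 ≤ r) {L : ℝ → ℝ} {ℓ : ℝ → ℝ≥0∞}
    (hm : Measurable ℓ) (hℓ : ∀ x, 0 < x → ℓ x = ENNReal.ofReal (L x)) {T : ℝ} (hT : 0 < T)
    {A : ℝ≥0∞} (hAfin : A ≠ ∞)
    (hA : ∀ Ω, 0 < Ω → A ≤ ∫⁻ x in Ioo T⁻¹ T, ENNReal.ofReal (phi r x) * ℓ (Ω / x))
    (G : Estimator r) : A ≤ supRisk r L G := by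
  by_contra! hlt
  have hSfin : supRisk r L G ≠ ∞ := hlt.ne_top
  have hlt' : (supRisk r L G).toReal < A.toReal := (ENNReal.toReal_lt_toReal hSfin hAfin).2 hlt
  obtain ⟨D, hD⟩ := exists_nat_ge (2 * ((r : ℝ) ^ 2 + T ^ 2))
  obtain ⟨m, hTm⟩ := exists_nat_ge (max (max (2 * T) (2 / T)) (max (D : ℝ) r))
  have hDm : D ≤ m := by
    exact_mod_cast ((le_max_left (D : ℝ) r).trans (le_max_right _ _)).trans hTm
  have hrm : r ≤ m := by
    exact_mod_cast ((le_max_right (D : ℝ) r).trans (le_max_right _ _)).trans hTm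
  have hTm1 : 2 * T ≤ m := ((le_max_left _ _).trans (le_max_left _ _)).trans hTm
  have hTm2 : 2 / T ≤ m := ((le_max_right _ _).trans (le_max_left _ _)).trans hTm
  set a := A.toReal with ha
  set s := (supRisk r L G).toReal with hs
  set C : ℝ := a * Real.log (m + D) + s * Real.log (T / 2) with hC
  -- Both sides grow like log k, with slopes `a` and `s` and bounded corrections collected in `C`; a
  -- < s would be consistent, but s < a is refuted by taking k large.
  have hlim : Tendsto (fun k : ℕ => (a - s) * Real.log k) atTop atTop :=
    (Real.tendsto_log_atTop.comp tendsto_natCast_atTop_atTop).const_mul_atTop (sub_pos.2 hlt')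
  obtain ⟨k, hkC, hmk⟩ := ((hlim.eventually_gt_atTop C).and (eventually_ge_atTop m)).exists
  have hmain := sum_mul_le_supRisk_mul_log hr hm hℓ hT hA G hD hDm hrm hTm1 hTm2 hmk
  have hm1 : 1 ≤ m := hr.trans hrm
  have hkm : (m : ℝ) ≤ k := by exact_mod_cast hmk
  have hk0 : (0 : ℝ) < k := lt_of_lt_of_le (by exact_mod_cast hm1) hkm
  have hlog0 : 0 ≤ Real.log (T * k / 2) := by
    refine Real.log_nonneg ?_
    rw [div_le_iff₀ hT] at hTm2
    nlinarith
  have hsum0 : 0 ≤ ∑ n ∈ Finset.Icc m k, 1 / ((n : ℝ) + D) :=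
    Finset.sum_nonneg fun n _ => by positivity
  have hreal := ENNReal.toReal_mono (ENNReal.mul_ne_top hSfin ENNReal.ofReal_ne_top) hmain
  rw [ENNReal.toReal_mul, ENNReal.toReal_mul, ENNReal.toReal_ofReal hsum0,
    ENNReal.toReal_ofReal hlog0] at hreal
  have hlogs := log_sub_log_le_sum hm1 hmk D
  have hlogk : Real.log k ≤ Real.log (k + 1) := Real.log_le_log hk0 (by linarith)
  have hsplit : Real.log (T * k / 2) = Real.log k + Real.log (T / 2) := by
    rw [← Real.log_mul hk0.ne' (by positivity)]
    congr 1
    ring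
  have ha0 : 0 ≤ a := ENNReal.toReal_nonneg
  have h1 : (Real.log k - Real.log (m + D)) * a ≤
      (∑ n ∈ Finset.Icc m k, 1 / ((n : ℝ) + D)) * a := by
    gcongr
    linarith
  rw [hsplit] at hreal
  have hkC' : C < (a - s) * Real.log k := hkC
  rw [hC] at hkC'
  linarith

/-- The asymptotic risk at the best `Ω` is a lower bound for the worst-case risk of every
estimator. -/
theorem gammaRisk_le_supRisk {r : ℕ} (hr : 1 ≤ r) {L : ℝ → ℝ} {c : ℝ} (hc : 0 < c)
    (hanti : AntitoneOn L (Ioc 0 c)) (hmono : MonotoneOn L (Ici c)) {ℓ : ℝ → ℝ≥0∞}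
    (hm : Measurable ℓ) (hℓ : ∀ x, 0 < x → ℓ x = ENNReal.ofReal (L x))
    (hfin : ∀ Ω, 0 < Ω → gammaRisk r ℓ Ω ≠ ∞) {Ω : ℝ}
    (hmin : ∀ Ω', 0 < Ω' → gammaRisk r ℓ Ω ≤ gammaRisk r ℓ Ω') (G : Estimator r) :
    gammaRisk r ℓ Ω ≤ supRisk r L G := by
  refine le_of_forall_lt_imp_le_of_dense fun A hA => ?_
  have hanti' : AntitoneOn ℓ (Ioc 0 c) := fun x hx y hy hxy => by
    rw [hℓ x hx.1, hℓ y hy.1]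
    exact ENNReal.ofReal_le_ofReal (hanti hx hy hxy)
  have hmono' : MonotoneOn ℓ (Ici c) := fun x hx y hy hxy => by
    rw [hℓ x (hc.trans_le hx), hℓ y (hc.trans_le hy)]
    exact ENNReal.ofReal_le_ofReal (hmono hx hy hxy)
  obtain ⟨T, hT, hAT⟩ := exists_truncation hc hanti' hmono' hm hfin hA hmin
  exact le_supRisk hr hm hℓ hT hA.ne_top hAT G

/-! ### Joining the two bounds -/

/-- Absorbing the constant stretch into the increasing side gives the loss a single turning point
`υ`, the shape used for finiteness and for the lower bound. -/
theorem IsConstantBetween.monotoneOn_Ici {L : ℝ → ℝ} {υ υ' : ℝ} (h : IsConstantBetween L υ υ')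
    (hυυ' : υ ≤ υ') : MonotoneOn L (Ici υ) := by
  obtain ⟨⟨C, hC⟩, -, hmono⟩ := h
  intro x hx y hy hxy
  rcases le_total x υ' with h1 | h1
  · rcases le_total y υ' with h2 | h2
    · rw [hC x ⟨hx, h1⟩, hC y ⟨hy, h2⟩]
    · rw [hC x ⟨hx, h1⟩, ← hC υ' ⟨hυυ', le_rfl⟩]
      exact hmono (mem_Ici.2 le_rfl) h2 h2
  · exact hmono h1 (mem_Ici.2 (h1.trans hxy)) hxy

end InverseBinomial

theorem mainTheorem9 (r : ℕ) (hr : 3 ≤ r) (L : ℝ → ℝ)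
    (hL : InverseBinomial.IsLoss L)
    (h1 : InverseBinomial.HasLocallyBoundedVariation L)
    (h2 : InverseBinomial.HasFinitelyManyDiscontinuities L)
    (h3 : InverseBinomial.HasPowerOrder r L)
    (h4left : InverseBinomial.LeftShape r L)
    (h4right : InverseBinomial.RightShape L)
    (Ωstar : ℝ) (hΩ : InverseBinomial.IsOptimalOmega r L Ωstar)
    (υ υ' : ℝ) (hυ : 0 < υ)
    (hυle : υ ≤ Ωstar / ((r : ℝ) + Real.sqrt r + 1))
    (hυ'ge : Ωstar / ((r : ℝ) - Real.sqrt r) ≤ υ')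
    (hconst : InverseBinomial.IsConstantBetween L υ υ')
    (G : InverseBinomial.Estimator r) :
    InverseBinomial.supRisk r L (InverseBinomial.Estimator.divSucc r Ωstar hΩ.1) ≤
      InverseBinomial.supRisk r L G := by
  obtain ⟨hΩ0, hopt⟩ := hΩ
  have hr1 : 1 ≤ r := by omega
  have hυυ' : υ ≤ υ' := by
    have hr3 : (3 : ℝ) ≤ r := by exact_mod_cast hr
    have hs2 : Real.sqrt r ^ 2 = r := Real.sq_sqrt (by linarith)
    have hs0 : 0 ≤ Real.sqrt r := Real.sqrt_nonneg _
    have hs1 : 3 / 2 ≤ Real.sqrt r := by nlinarith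
    have hy : 0 < (r : ℝ) - Real.sqrt r := by nlinarith
    refine hυle.trans (le_trans ?_ hυ'ge)
    gcongr
    linarith
  have hmono := hconst.monotoneOn_Ici hυυ'
  obtain ⟨ℓ, hm, hℓ⟩ := InverseBinomial.exists_measurable_eq_ofReal hυ hconst.2.1 hmono
  have hfin : ∀ Ω, 0 < Ω → InverseBinomial.gammaRisk r ℓ Ω ≠ ∞ := fun Ω hΩ =>
    InverseBinomial.gammaRisk_ne_top hr1 hL h3 hconst.2.1 hmono hℓ hΩ
  have hmin : ∀ Ω', 0 < Ω' →
      InverseBinomial.gammaRisk r ℓ Ωstar ≤ InverseBinomial.gammaRisk r ℓ Ω' := fun Ω' hΩ' => by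
    rw [← InverseBinomial.asymptoticRisk_eq_gammaRisk r hℓ hΩ0,
      ← InverseBinomial.asymptoticRisk_eq_gammaRisk r hℓ hΩ']
    exact hopt Ω' hΩ'
  exact (InverseBinomial.supRisk_divSucc_le hr hL hΩ0 hυ hυle hυ'ge hconst hm hℓ hfin hmin).trans
    (InverseBinomial.gammaRisk_le_supRisk hr1 hυ hconst.2.1 hmono hm hℓ hfin hmin G)
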